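/- Consider a continuous-time level-dependent QBD process, i.e. a continuous-time Markov chain whose (conservative) infinitesimal generator is $$Q=\begin{pmatrix}A_1^{(0)}&A_0^{(0)}&&&\\A_2^{(1)}&A_1^{(1)}&A_0^{(1)}&&\\&A_2^{(2)}&A_1^{(2)}&A_0^{(2)}&\\&&\ddots&\ddots&\ddots\end{pmatrix},$$ where $A_1^{(0)}$ has size $m_0\ge1$ and $A_1^{(k)}$ has size $m$ for $k\ge1$. Assume that the chain is irreducible and positive recurrent, let $x=(x_0,x_1,x_2,\dots)$ be its stationary probability vector ($x\ge0$, $xe=1$, $xQ=0$), and let $\pi=(\pi_1,\pi_2,\dots)$ with $\pi_k=\sum_{j\ge k}x_j$. Put $$\widehat Q=\begin{pmatrix}A_1^{(1)}&A_0^{(1)}&&\\A_2^{(2)}&A_1^{(2)}&A_0^{(2)}&\\&\ddots&\ddots&\ddots\end{pmatrix},\qquad \mathbb Q=\begin{pmatrix}\mathbf 0\\ \widehat Q\end{pmatrix},$$ where $\mathbf 0$ is one zero block row. Put $\Psi_0=A_1^{(1)}$ and, for $k\ge1$, $\Psi_k=A_1^{(k+1)}+A_2^{(k+1)}(-\Psi_{k-1}^{-1})A_0^{(k)}$,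 $\mathbf R_k=A_2^{(k+1)}(-\Psi_{k-1}^{-1})$ and $\mathbf G_{k-1}=(-\Psi_{k-1}^{-1})A_0^{(k)}$. Let $\mathbb R_L$ have the blocks $\mathbf R_1,\mathbf R_2,\dots$ directly below the block diagonal, let $\mathbb G_U$ have the blocks $\mathbf G_0,\mathbf G_1,\dots$ directly above it (all other blocks being $0$), and let $\mathbb U_D=\mathrm{diag}(\Psi_0,\Psi_1,\dots)$. Then, all products and sums of infinite matrices below converging entrywise: 1. $\pi(\widehat Q-\mathbb Q)=-(x_0A_0^{(0)},0,0,\dots)$. 2. Each $\Psi_l$, $l\ge0$, has nonnegative off-diagonal entries and nonpositive row sums, is invertible, and satisfies $-\Psi_l^{-1}\ge0$. The sequence $\{\mathbf R_k\}_{k\ge1}$ is the unique nonnegative solution of $\mathbf R_{k+1}\mathbf R_kA_0^{(k)}+\mathbf R_{k+1}A_1^{(k+1)}+A_2^{(k+2)}=0$ ($k\ge1$) with $\mathbf R_1=A_2^{(2)}(-\Psi_0^{-1})$, and $\{\mathbf G_k\}_{k\ge0}$ is the unique nonnegative solution of $A_0^{(k+1)}+A_1^{(k+1)}\mathbf G_k+A_2^{(k+1)}\mathbf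 G_{k-1}\mathbf G_k=0$ ($k\ge1$) with $\mathbf G_0=(-\Psi_0^{-1})A_0^{(1)}$. For $k\ge1$ they satisfy the recursions (with invertible brackets) $\mathbf R_{k+1}=-A_2^{(k+2)}[\mathbf R_kA_0^{(k)}+A_1^{(k+1)}]^{-1}$ and $\mathbf G_k=-[A_1^{(k+1)}+A_2^{(k+1)}\mathbf G_{k-1}]^{-1}A_0^{(k+1)}$. 3. $\widehat Q=(I-\mathbb R_L)\,\mathbb U_D\,(I-\mathbb G_U)$. The three factors have the two-sided inverses $(I-\mathbb R_L)^{-1}$, block lower triangular with identity diagonal blocks and $(l,l-k)$ block $X_k^{(l)}=\mathbf R_l\mathbf R_{l-1}\cdots\mathbf R_{l-k+1}$ ($l\ge k\ge1$); $\mathbb U_D^{-1}=\mathrm{diag}(\Psi_0^{-1},\Psi_1^{-1},\dots)$; and $(I-\mathbb G_U)^{-1}$, block upper triangular with identity diagonal blocks and $(l,l+k)$ block $Y_k^{(l)}=\mathbf G_l\mathbf G_{l+1}\cdots\mathbf G_{l+k-1}$ ($k\ge1$, $l\ge0$), where block rows and columns are numbered from $0$. 4. $\widehat Q$ has a maximal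 non-positive inverse $\widehat Q_{\max}^{-1}$ (the entrywise greatest among its two-sided inverses with non-positive entries), and $$\widehat Q_{\max}^{-1}=(I-\mathbb G_U)^{-1}\,\mathbb U_D^{-1}\,(I-\mathbb R_L)^{-1}.$$ 5. $\pi\bigl(I-\mathbb Q\widehat Q_{\max}^{-1}\bigr)=-(x_0A_0^{(0)},0,0,\dots)\widehat Q_{\max}^{-1}$, and $$\pi=-(x_0A_0^{(0)},0,0,\dots)\,\widehat Q_{\max}^{-1}\sum_{k=0}^{\infty}\bigl(\mathbb Q\widehat Q_{\max}^{-1}\bigr)^k .$$ -/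

import Mathlib

open scoped ENNReal

noncomputable section

/-! ### Infinite matrices and row vectors

A product of infinite matrices is an entrywise (unconditionally convergent) series, so it is a
relation: it holds only if all the series converge. -/

/-- `A B = C` for possibly infinite matrices: every entry of the product converges. -/
def HasMatMul {I J K : Type*} (A : Matrix I J ℝ) (B : Matrix J K ℝ) (C : Matrix I K ℝ) : Prop :=
  ∀ i k, HasSum (fun j => A i j * B j k) (C i k)

/-- `(A B) C = D`. -/
def HasMatMul₃ {I J K L : Type*} (A : Matrix I J ℝ) (B : Matrix J K ℝ) (C : Matrix K L ℝ)
    (D : Matrix I L ℝ) : Prop :=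
  ∃ T : Matrix I K ℝ, HasMatMul A B T ∧ HasMatMul T C D

/-- `v M = w` for row vectors `v`, `w`. -/
def HasVecMul {I J : Type*} (v : I → ℝ) (M : Matrix I J ℝ) (w : J → ℝ) : Prop :=
  ∀ j, HasSum (fun i => v i * M i j) (w j)

/-- `W` is a two-sided inverse of `M`. -/
def IsMatInverse {I : Type*} [DecidableEq I] (M W : Matrix I I ℝ) : Prop :=
  HasMatMul M W 1 ∧ HasMatMul W M 1

/-- `V` is the maximal non-positive inverse of `M`: the entrywise greatest one among the
inverses of `M` with non-positive entries. -/
def IsMaxNonposInverse {I : Type*} [DecidableEq I] (M V : Matrix I I ℝ) : Prop :=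
  IsMatInverse M V ∧ (∀ i j, V i j ≤ 0) ∧
    ∀ W : Matrix I I ℝ, IsMatInverse M W → (∀ i j, W i j ≤ 0) → ∀ i j, W i j ≤ V i j

/-- `S = ∑_{k ≥ 0} W ^ k`, with every power `P k = W ^ k` and the sum converging entrywise. -/
def HasPowerSum {I : Type*} [DecidableEq I] (W S : Matrix I I ℝ) : Prop :=
  ∃ P : ℕ → Matrix I I ℝ, P 0 = 1 ∧ (∀ k, HasMatMul (P k) W (P (k + 1))) ∧
    ∀ i j, HasSum (fun k => P k i j) (S i j)

/-! ### Continuous-time Markov chains on a countable state space -/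

/-- `Q` is a (conservative) infinitesimal generator. -/
def IsGenerator {E : Type*} (Q : Matrix E E ℝ) : Prop :=
  (∀ i j, i ≠ j → 0 ≤ Q i j) ∧ ∀ i, HasSum (fun j => Q i j) 0

/-- Any state can be reached from any state through transitions of positive rate. -/
def IsIrreducibleGenerator {E : Type*} (Q : Matrix E E ℝ) : Prop :=
  ∀ i j, Relation.ReflTransGen (fun a b => 0 < Q a b) i j

/-- Transition probabilities of the embedded jump chain. -/
def jumpProb {E : Type*} [DecidableEq E] (Q : Matrix E E ℝ) (i j : E) : ℝ≥0∞ :=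
  if Q i i = 0 then (if i = j then 1 else 0)
  else if i = j then 0 else ENNReal.ofReal (Q i j / (-Q i i))

/-- `tabooProb Q i n j` is the probability that the jump chain `Y` started at `Y 0 = i` has
`Y n = j` and `Y m ≠ i` for `1 ≤ m ≤ n`. -/
def tabooProb {E : Type*} [DecidableEq E] (Q : Matrix E E ℝ) (i : E) : ℕ → E → ℝ≥0∞
  | 0 => fun j => if j = i then 1 else 0
  | n + 1 => fun k => if k = i then 0 else ∑' j, tabooProb Q i n j * jumpProb Q j k

/-- The probability of ever returning to `i`: the sum over `n` of the probabilities that the first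
return of the jump chain to `i` happens at step `n + 1`. -/
def returnProb {E : Type*} [DecidableEq E] (Q : Matrix E E ℝ) (i : E) : ℝ≥0∞ :=
  ∑' n, ∑' j, tabooProb Q i n j * jumpProb Q j i

/-- The expected time spent until the first return to `i`: before its first return the chain makes
its `n`-th visit in `j` with probability `tabooProb Q i n j`, and then stays there for an
exponential time with mean `1 / (-Q j j)`. -/
def meanReturnTime {E : Type*} [DecidableEq E] (Q : Matrix E E ℝ) (i : E) : ℝ≥0∞ :=
  ∑' n, ∑' j, tabooProb Q i n j * (ENNReal.ofReal (-Q j j))⁻¹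

/-- Every state is absorbing, or is returned to with probability one and in finite mean time. -/
def IsPositiveRecurrent {E : Type*} [DecidableEq E] (Q : Matrix E E ℝ) : Prop :=
  ∀ i, Q i i = 0 ∨ (returnProb Q i = 1 ∧ meanReturnTime Q i ≠ ∞)

/-- `x` is a stationary probability vector: `x ≥ 0`, `x e = 1`, `x Q = 0`. -/
def IsStationaryProb {E : Type*} (Q : Matrix E E ℝ) (x : E → ℝ) : Prop :=
  (∀ i, 0 ≤ x i) ∧ HasSum x 1 ∧ HasVecMul x Q 0

/-! ### Level-dependent QBD processes -/

/-- The blocks of a level-dependent QBD process. `α` is the set of phases of level `0`, and `β` is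
the set of phases of every level `k ≥ 1`. Level `0` has the blocks `B1 = A_1^{(0)}`,
`B0 = A_0^{(0)}` and level `1` has the downward block `B2 = A_2^{(1)}`; `A0 k`, `A1 k` (`k ≥ 1`) and
`A2 k` (`k ≥ 2`) are `A_0^{(k)}`, `A_1^{(k)}`, `A_2^{(k)}`; their other values are never used. -/
structure LDQBD (α β : Type*) where
  B1 : Matrix α α ℝ
  B0 : Matrix α β ℝ
  B2 : Matrix β α ℝ
  A0 : ℕ → Matrix β β ℝ
  A1 : ℕ → Matrix β β ℝ
  A2 : ℕ → Matrix β β ℝ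

/-- The infinite matrix with the given `β × β` blocks; block rows and columns are numbered
`0, 1, 2, …`. -/
def blockMatrix {β : Type*} (F : ℕ → ℕ → Matrix β β ℝ) : Matrix (ℕ × β) (ℕ × β) ℝ :=
  fun p q => F p.1 q.1 p.2 q.2

namespace LDQBD

variable {α β : Type*}

/-- The block tridiagonal matrix `Q̂` of levels `1, 2, …`; block row `i` belongs to
level `i + 1`. -/
def Qhat (D : LDQBD α β) : Matrix (ℕ × β) (ℕ × β) ℝ :=
  blockMatrix fun i j =>
    if j = i then D.A1 (i + 1)
    else if j = i + 1 then D.A0 (i + 1)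
    else if i = j + 1 then D.A2 (i + 1)
    else 0

/-- The generator `Q`; the state `Sum.inl a` is phase `a` of level `0`, and `Sum.inr (i, b)` is
phase `b` of level `i + 1`. -/
def generator (D : LDQBD α β) : Matrix (α ⊕ ℕ × β) (α ⊕ ℕ × β) ℝ :=
  Matrix.fromBlocks D.B1
    (fun a p => if p.1 = 0 then D.B0 a p.2 else 0)
    (fun p a => if p.1 = 0 then D.B2 p.2 a else 0)
    D.Qhat

/-- The matrix `ℚ` whose first block row is `0` and whose other block rows are those of `Q̂`. -/
def shiftedQhat (D : LDQBD α β) : Matrix (ℕ × β) (ℕ × β) ℝ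
  | (0, _), _ => 0
  | (i + 1, b), q => D.Qhat (i, b) q

/-- `(π_1, π_2, …)` with `π_{i+1} = ∑_{j ≥ i+1} x_j`. -/
def tail (x : α ⊕ ℕ × β → ℝ) : ℕ × β → ℝ :=
  fun p => ∑' j : ℕ, x (Sum.inr (p.1 + j, p.2))

/-- The row vector `-(x_0 A_0^{(0)}, 0, 0, …)`. -/
def boundaryVec [Fintype α] (D : LDQBD α β) (x : α ⊕ ℕ × β → ℝ) : ℕ × β → ℝ :=
  fun p => if p.1 = 0 then -(Matrix.vecMul (fun a => x (Sum.inl a)) D.B0 p.2) else 0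

variable [Fintype β] [DecidableEq β]

/-- The `U`-measure `Ψ_k`. -/
def Psi (D : LDQBD α β) : ℕ → Matrix β β ℝ
  | 0 => D.A1 1
  | k + 1 => D.A1 (k + 2) + D.A2 (k + 2) * (-(Psi D k)⁻¹) * D.A0 (k + 1)

/-- The `R`-measure `𝐑_k`, `k ≥ 1` (the value at `0` is not used). -/
def R (D : LDQBD α β) : ℕ → Matrix β β ℝ
  | 0 => 0
  | k + 1 => D.A2 (k + 2) * (-(D.Psi k)⁻¹)

/-- The `G`-measure `𝐆_k`, `k ≥ 0`. -/
def G (D : LDQBD α β) (k : ℕ) : Matrix β β ℝ :=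
  (-(D.Psi k)⁻¹) * D.A0 (k + 1)

/-- `X_k^{(l)} = 𝐑_l 𝐑_{l-1} ⋯ 𝐑_{l-k+1}` for `k ≤ l` (and `X_0^{(l)} = I`). -/
def X (D : LDQBD α β) (l : ℕ) : ℕ → Matrix β β ℝ
  | 0 => 1
  | k + 1 => X D l k * D.R (l - k)

/-- `Y_k^{(l)} = 𝐆_l 𝐆_{l+1} ⋯ 𝐆_{l+k-1}` (and `Y_0^{(l)} = I`). -/
def Y (D : LDQBD α β) (l : ℕ) : ℕ → Matrix β β ℝ
  | 0 => 1
  | k + 1 => Y D l k * D.G (l + k)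

/-- `ℝ_L`, with the blocks `𝐑_1, 𝐑_2, …` below the diagonal. -/
def RL (D : LDQBD α β) : Matrix (ℕ × β) (ℕ × β) ℝ :=
  blockMatrix fun i j => if i = j + 1 then D.R i else 0

/-- `𝕌_D = diag(Ψ_0, Ψ_1, …)`. -/
def UD (D : LDQBD α β) : Matrix (ℕ × β) (ℕ × β) ℝ :=
  blockMatrix fun i j => if i = j then D.Psi i else 0

/-- `𝔾_U`, with the blocks `𝐆_0, 𝐆_1, …` above the diagonal. -/
def GU (D : LDQBD α β) : Matrix (ℕ × β) (ℕ × β) ℝ :=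
  blockMatrix fun i j => if j = i + 1 then D.G i else 0

/-- `(I - ℝ_L)⁻¹`: the block lower triangular matrix with the blocks `X_{i-j}^{(i)}`. -/
def RLinv (D : LDQBD α β) : Matrix (ℕ × β) (ℕ × β) ℝ :=
  blockMatrix fun i j => if j ≤ i then D.X i (i - j) else 0

/-- `𝕌_D⁻¹ = diag(Ψ_0⁻¹, Ψ_1⁻¹, …)`. -/
def UDinv (D : LDQBD α β) : Matrix (ℕ × β) (ℕ × β) ℝ :=
  blockMatrix fun i j => if i = j then (D.Psi i)⁻¹ else 0

/-- `(I - 𝔾_U)⁻¹`: the block upper triangular matrix with the blocks `Y_{j-i}^{(i)}`. -/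
def GUinv (D : LDQBD α β) : Matrix (ℕ × β) (ℕ × β) ℝ :=
  blockMatrix fun i j => if i ≤ j then D.Y i (j - i) else 0

/-- `S` solves `S_{k+1} S_k A_0^{(k)} + S_{k+1} A_1^{(k+1)} + A_2^{(k+2)} = 0` for `k ≥ 1`, with
`S_1 = A_2^{(2)} (-Ψ_0⁻¹)`, and `S_k ≥ 0` for `k ≥ 1`. -/
def IsNonnegRSolution (D : LDQBD α β) (S : ℕ → Matrix β β ℝ) : Prop :=
  (∀ k, 1 ≤ k → ∀ a b, 0 ≤ S k a b) ∧ S 1 = D.A2 2 * (-(D.Psi 0)⁻¹) ∧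
    ∀ k, 1 ≤ k → S (k + 1) * S k * D.A0 k + S (k + 1) * D.A1 (k + 1) + D.A2 (k + 2) = 0

/-- `S` solves `A_0^{(k+1)} + A_1^{(k+1)} S_k + A_2^{(k+1)} S_{k-1} S_k = 0` for `k ≥ 1`, with
`S_0 = (-Ψ_0⁻¹) A_0^{(1)}`, and `S_k ≥ 0` for `k ≥ 0`. -/
def IsNonnegGSolution (D : LDQBD α β) (S : ℕ → Matrix β β ℝ) : Prop :=
  (∀ k, ∀ a b, 0 ≤ S k a b) ∧ S 0 = (-(D.Psi 0)⁻¹) * D.A0 1 ∧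
    ∀ k, 1 ≤ k → D.A0 (k + 1) + D.A1 (k + 1) * S k + D.A2 (k + 1) * S (k - 1) * S k = 0

end LDQBD

end

/-!
`Q̂` generates the chain killed on leaving the levels above `0`. A vector `w` on level `l` extends
downwards by `(I - 𝔾_U)⁻¹` to a finitely supported vector on which `Q̂` is `Ψ_l w` in level `l` and
`0` below it, so the minimum principle of the irreducible generator `Q` gives `w ≥ 0` whenever
`Ψ_l w ≤ 0`: hence `Ψ_l` is invertible and `-Ψ_l⁻¹ ≥ 0`, by induction on `l`. The factorization of
`Q̂` is then block algebra, in which products may be rebracketed as long as an outer factor has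
finite rows (on the left) or finite columns (on the right).

Only the series for `V = (I - 𝔾_U)⁻¹ 𝕌_D⁻¹ (I - ℝ_L)⁻¹` is infinite. As `Q̂ 1` is minus the vector
of the rates into level `0`, the constant vector bounds `-V` times these rates; so the columns of
`V` at states that lead directly to level `0` converge, and convergence spreads backwards along the
transitions to all states. For a nonpositive inverse `W`, the nonnegative `-W` solves
`𝕌_D (I - 𝔾_U) H = -(I - ℝ_L)⁻¹`, whose minimal nonnegative solution is `-V`; thus `W ≤ V`.

The vector `u = -(x_0 A_0^{(0)}, 0, …) V` is at most `(x_1, x_2, …)`, so `(x_0, u)` is a nonnegative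
subinvariant vector of `Q`. By recurrence it is determined by its value at one state of level `0`,
so it is `x`. Finally `ℚ V` drops the first level of a row vector, so that its powers turn
`u = (x_1, x_2, …)` into the tail sums `π`.
-/

/-! ### Products of infinite matrices -/

section InfiniteMatrices

open Function

variable {I J K L : Type*}

/-- Every row has finitely many nonzero entries, so that any product with the matrix on the left
converges. -/
def RowFinite (A : Matrix I J ℝ) : Prop := ∀ i, (support (A i)).Finite

/-- Every column has finitely many nonzero entries, so that any product with the matrix on the
right converges. -/
def ColFinite (A : Matrix I J ℝ) : Prop := RowFinite A.transpose

namespace HasMatMul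

variable {A : Matrix I J ℝ} {B : Matrix J K ℝ} {C : Matrix K L ℝ}

theorem transpose {M : Matrix I K ℝ} (h : HasMatMul A B M) :
    HasMatMul B.transpose A.transpose M.transpose := fun k i => by
  simpa only [Matrix.transpose_apply, mul_comm] using h i k

theorem unique {M M' : Matrix I K ℝ} (h : HasMatMul A B M) (h' : HasMatMul A B M') : M = M' :=
  Matrix.ext fun i k => (h i k).unique (h' i k)

theorem one_left [DecidableEq I] (A : Matrix I J ℝ) : HasMatMul 1 A A := fun i j => by
  simpa using hasSum_single (f := fun k => (1 : Matrix I I ℝ) i k * A k j) i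
    fun k hk => by rw [Matrix.one_apply_ne hk.symm, zero_mul]

theorem one_right [DecidableEq J] (A : Matrix I J ℝ) : HasMatMul A 1 A := by
  simpa using (one_left A.transpose).transpose

theorem neg_left {M : Matrix I K ℝ} (h : HasMatMul A B M) : HasMatMul (-A) B (-M) := fun i k => by
  simpa using (h i k).neg

theorem neg_right {M : Matrix I K ℝ} (h : HasMatMul A B M) : HasMatMul A (-B) (-M) := fun i k => by
  simpa using (h i k).neg

theorem sub_left {A' : Matrix I J ℝ} {M M' : Matrix I K ℝ} (h : HasMatMul A B M)
    (h' : HasMatMul A' B M') : HasMatMul (A - A') B (M - M') := fun i k => by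
  simpa [sub_mul] using (h i k).sub (h' i k)

theorem exists_of_rowFinite (hA : RowFinite A) (B : Matrix J K ℝ) : ∃ M, HasMatMul A B M :=
  ⟨fun i k => ∑' j, A i j * B j k, fun i _ => (summable_of_hasFiniteSupport <|
    (hA i).subset (support_mul_subset_left _ _)).hasSum⟩

theorem hasSum_mulVec [Fintype K] {M : Matrix I K ℝ} (h : HasMatMul A B M) (w : K → ℝ) (i : I) :
    HasSum (fun j => A i j * B.mulVec w j) (M.mulVec w i) := by
  simp only [Matrix.mulVec, dotProduct, Finset.mul_sum, ← mul_assoc]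
  exact hasSum_sum fun k _ => (h i k).mul_right (w k)

theorem exists_common_of_rowFinite (hA : RowFinite A) {AB : Matrix I K ℝ} {BC : Matrix J L ℝ}
    (hAB : HasMatMul A B AB) (hBC : HasMatMul B C BC) :
    ∃ M, HasMatMul AB C M ∧ HasMatMul A BC M := by
  have vanish : ∀ i, ∀ j ∉ (hA i).toFinset, A i j = 0 := fun i j hj => by simpa using hj
  refine ⟨fun i l => ∑ j ∈ (hA i).toFinset, A i j * BC j l, fun i l => ?_, fun i l =>
    hasSum_sum_of_ne_finset_zero fun j hj => by rw [vanish i j hj, zero_mul]⟩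
  have expand : ∀ k, AB i k = ∑ j ∈ (hA i).toFinset, A i j * B j k := fun k =>
    (hAB i k).unique <| hasSum_sum_of_ne_finset_zero fun j hj => by rw [vanish i j hj, zero_mul]
  simp only [expand, Finset.sum_mul, mul_assoc]
  exact hasSum_sum fun j _ => (hBC j l).mul_left (A i j)

theorem assoc_of_rowFinite (hA : RowFinite A) {AB : Matrix I K ℝ} {BC : Matrix J L ℝ}
    {M : Matrix I L ℝ} (hAB : HasMatMul A B AB) (hBC : HasMatMul B C BC) :
    HasMatMul AB C M ↔ HasMatMul A BC M := by
  obtain ⟨M', h, h'⟩ := exists_common_of_rowFinite hA hAB hBC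
  exact ⟨fun hM => hM.unique h ▸ h', fun hM => hM.unique h' ▸ h⟩

theorem assoc_of_colFinite (hC : ColFinite C) {AB : Matrix I K ℝ} {BC : Matrix J L ℝ}
    {M : Matrix I L ℝ} (hAB : HasMatMul A B AB) (hBC : HasMatMul B C BC) :
    HasMatMul AB C M ↔ HasMatMul A BC M := by
  have h := assoc_of_rowFinite (M := M.transpose) hC hBC.transpose hAB.transpose
  exact ⟨fun hM => (h.2 hM.transpose).transpose, fun hM => (h.1 hM.transpose).transpose⟩

end HasMatMul

theorem hasVecMul_iff_hasMatMul {v : I → ℝ} {M : Matrix I J ℝ} {w : J → ℝ} :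
    HasVecMul v M w ↔
      HasMatMul (Matrix.replicateRow Unit v) M (Matrix.replicateRow Unit w) :=
  ⟨fun h _ j => h j, fun h j => h () j⟩

/-- The finite sets `F` such that `A` is block upper triangular for the splitting of the indices
into `F` and its complement exhaust the index set. -/
def TriangularlyExhausted (A : Matrix I I ℝ) : Prop :=
  ∀ F₀ : Finset I, ∃ F, F₀ ⊆ F ∧ ∀ r ∉ F, ∀ s ∈ F, A r s = 0

theorem TriangularlyExhausted.neg {A : Matrix I I ℝ} (h : TriangularlyExhausted A) :
    TriangularlyExhausted (-A) := by
  simpa only [TriangularlyExhausted, Matrix.neg_apply, neg_eq_zero] using h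

/-- On a finite `F` that `A` maps to itself, the `F`-truncation of `B A = 1` is exact in the columns
of `F` and only loses nonpositive terms in the others, so the truncated `B (A H)` is at most `H`. -/
theorem sum_mul_le_of_hasMatMul [DecidableEq I] {A B : Matrix I I ℝ} {H C : Matrix I K ℝ}
    (hA : ∀ i j, i ≠ j → A i j ≤ 0) (hB : ∀ i j, 0 ≤ B i j) (hH : ∀ i k, 0 ≤ H i k)
    (hBA : HasMatMul B A 1) (hAH : HasMatMul A H C) {F : Finset I}
    (hF : ∀ r ∉ F, ∀ s ∈ F, A r s = 0) (p : I) (q : K) :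
    ∑ r ∈ F, B p r * C r q ≤ H p q := by
  have truncated_le : ∀ s, ∑ r ∈ F, B p r * A r s ≤ (1 : Matrix I I ℝ) p s := fun s => by
    by_cases hs : s ∈ F
    · exact ((hasSum_sum_of_ne_finset_zero fun r hr => by rw [hF r hr s hs, mul_zero]).unique
        (hBA p s)).le
    · have one_nonneg : 0 ≤ (1 : Matrix I I ℝ) p s := by
        rw [Matrix.one_apply]; split_ifs <;> norm_num
      exact (Finset.sum_nonpos fun r hr => mul_nonpos_of_nonneg_of_nonpos (hB p r)
        (hA r s fun h => hs (h ▸ hr))).trans one_nonneg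
  refine hasSum_le (fun s => ?_) (hasSum_sum fun r _ => (hAH r q).mul_left (B p r))
    (HasMatMul.one_left H p q)
  simp only [← mul_assoc, ← Finset.sum_mul]
  exact mul_le_mul_of_nonneg_right (truncated_le s) (hH s q)

/-- In other words, `B C` is the minimal nonnegative solution of `A H = C`. -/
theorem summable_and_tsum_le_of_hasMatMul [DecidableEq I] {A B : Matrix I I ℝ} {H C : Matrix I K ℝ}
    (hA : ∀ i j, i ≠ j → A i j ≤ 0) (hB : ∀ i j, 0 ≤ B i j) (hH : ∀ i k, 0 ≤ H i k)
    (hC : ∀ i k, 0 ≤ C i k) (hBA : HasMatMul B A 1) (hAH : HasMatMul A H C)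
    (hexh : TriangularlyExhausted A) (p : I) (q : K) :
    Summable (fun r => B p r * C r q) ∧ ∑' r, B p r * C r q ≤ H p q := by
  have hnn : ∀ r, 0 ≤ B p r * C r q := fun r => mul_nonneg (hB p r) (hC r q)
  have hle : ∀ F₀ : Finset I, ∑ r ∈ F₀, B p r * C r q ≤ H p q := fun F₀ => by
    obtain ⟨F, hF₀, hF⟩ := hexh F₀
    exact (Finset.sum_le_sum_of_subset_of_nonneg hF₀ fun r _ _ => hnn r).trans
      (sum_mul_le_of_hasMatMul hA hB hH hBA hAH hF p q)
  exact ⟨summable_of_sum_le hnn hle, Real.tsum_le_of_sum_le hnn hle⟩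

/-- Away from finitely many `r`, column `q` of `L Q = U` bounds `L r q' * Q q' q` by
`L r q * -Q q q`. -/
theorem summable_mul_of_hasMatMul_of_pos {w : I → ℝ} (hw : ∀ r, 0 ≤ w r) {L : Matrix I J ℝ}
    (hL : ∀ r j, 0 ≤ L r j) {Q : Matrix J J ℝ} (hQ : ∀ i j, i ≠ j → 0 ≤ Q i j) {U : Matrix I J ℝ}
    (hLQ : HasMatMul L Q U) (hU : ColFinite U) {q q' : J} (hpos : 0 < Q q' q)
    (hsum : Summable fun r => w r * L r q) : Summable fun r => w r * L r q' := by
  rcases eq_or_ne q' q with rfl | hne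
  · exact hsum
  refine (hsum.mul_left (-Q q q / Q q' q)).of_norm_bounded_eventually ?_
  filter_upwards [(hU q).compl_mem_cofinite] with r hr
  have hUr : U r q = 0 := by simpa using hr
  have hpair : L r q' * Q q' q + L r q * Q q q ≤ 0 := by
    classical
    have hle := sum_le_hasSum {q', q} (fun j hj => mul_nonneg (hL r j) (hQ j q fun h => hj (by
      simp [h]))) (hLQ r q)
    rwa [Finset.sum_pair hne, hUr] at hle
  rw [Real.norm_of_nonneg (mul_nonneg (hw r) (hL r q')), div_mul_eq_mul_div, le_div_iff₀ hpos]
  nlinarith [mul_le_mul_of_nonneg_left hpair (hw r)]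

end InfiniteMatrices

/-! ### Irreducible generators -/

section Generators

variable {E : Type*} {Q : Matrix E E ℝ}

namespace IsIrreducibleGenerator

/-- Minimum principle: a negative minimum of `u` would spread along the transitions to `z`. -/
theorem nonneg_of_mulVec_nonpos (hirr : IsIrreducibleGenerator Q) (hQ : IsGenerator Q) {u : E → ℝ}
    (hfin : u.support.Finite) {z : E} (hz : u z = 0)
    (hu : ∀ i, u i < 0 → ∃ s ≤ 0, HasSum (fun j => Q i j * u j) s) (i : E) : 0 ≤ u i := by
  by_contra! hi
  obtain ⟨m, -, hmin⟩ := Set.exists_min_image _ u hfin ⟨i, hi.ne⟩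
  have hm0 : u m < 0 := (hmin i hi.ne).trans_lt hi
  have hle : ∀ j, u m ≤ u j := fun j => by
    by_cases hj : u j = 0
    · exact hj ▸ hm0.le
    · exact hmin j hj
  have eq_min : ∀ j, Relation.ReflTransGen (fun a b => 0 < Q a b) m j → u j = u m := by
    intro j hj
    induction hj with
    | refl => rfl
    | @tail b c _ hbc ih =>
      obtain ⟨s, hs, hsum⟩ := hu b (ih ▸ hm0)
      have hshift : HasSum (fun j => Q b j * (u j - u m)) (s - 0 * u m) := by
        simpa only [mul_sub] using hsum.sub ((hQ.2 b).mul_right (u m))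
      have hnn : ∀ j, 0 ≤ Q b j * (u j - u m) := fun j => by
        rcases eq_or_ne b j with rfl | hbj
        · rw [ih, sub_self, mul_zero]
        · exact mul_nonneg (hQ.1 b j hbj) (sub_nonneg.2 (hle j))
      have hc : Q b c * (u c - u m) ≤ s - 0 * u m := le_hasSum hshift c fun j _ => hnn j
      nlinarith [hle c]
  exact hm0.ne (eq_min z (hirr m z) ▸ hz)

theorem diag_neg [Nontrivial E] (hirr : IsIrreducibleGenerator Q) (hQ : IsGenerator Q) (i : E) :
    Q i i < 0 := by
  classical
  obtain ⟨k, hki, hk⟩ : ∃ k, k ≠ i ∧ 0 < Q i k := by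
    obtain ⟨j, hj⟩ := exists_ne i
    by_contra! hno
    have stuck : ∀ k, Relation.ReflTransGen (fun a b => 0 < Q a b) i k → k = i := by
      intro k hk
      induction hk with
      | refl => rfl
      | tail _ hbc ih => exact by_contra fun hne => (hno _ hne).not_gt (ih ▸ hbc)
    exact hj (stuck j (hirr i j))
  have hle := sum_le_hasSum {i, k} (fun l hl => hQ.1 i l fun h => hl (by simp [h])) (hQ.2 i)
  rw [Finset.sum_pair hki.symm] at hle
  linarith

end IsIrreducibleGenerator

variable [DecidableEq E]

/-- The expected number of visits of the jump chain started at `i` to a state before the first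
return to `i`. -/
noncomputable def tabooMeasure (Q : Matrix E E ℝ) (i j : E) : ℝ≥0∞ := ∑' n, tabooProb Q i n j

theorem tabooMeasure_self (Q : Matrix E E ℝ) (i : E) : tabooMeasure Q i i = 1 := by
  rw [tabooMeasure, tsum_eq_single 0]
  · simp [tabooProb]
  · rintro (_ | n) hn
    · exact absurd rfl hn
    · simp [tabooProb]

theorem tabooMeasure_invariant {i : E} (h : returnProb Q i = 1) (k : E) :
    ∑' j, tabooMeasure Q i j * jumpProb Q j k = tabooMeasure Q i k := by
  have hcomm : ∑' j, tabooMeasure Q i j * jumpProb Q j k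
      = ∑' n, ∑' j, tabooProb Q i n j * jumpProb Q j k := by
    simp_rw [tabooMeasure, ← ENNReal.tsum_mul_right]
    exact ENNReal.tsum_comm
  rw [hcomm]
  rcases eq_or_ne k i with rfl | hk
  · rw [tabooMeasure_self]; exact h
  · rw [tabooMeasure, tsum_eq_zero_add' (f := fun n => tabooProb Q i n k) ENNReal.summable]
    simp only [tabooProb, hk, if_false, zero_add]

theorem mul_tabooMeasure_le_of_subinvariant (i : E) {ν : E → ℝ≥0∞}
    (h : ∀ k, ∑' j, ν j * jumpProb Q j k ≤ ν k) (j : E) : ν i * tabooMeasure Q i j ≤ ν j := by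
  have partial_sum_le : ∀ n j, ∑ l ∈ Finset.range n, ν i * tabooProb Q i l j ≤ ν j := by
    intro n
    induction n with
    | zero => simp
    | succ n ih =>
      intro k
      rw [Finset.sum_range_succ']
      rcases eq_or_ne k i with rfl | hk
      · simp [tabooProb]
      · simp only [tabooProb, hk, if_false, mul_zero, add_zero]
        refine le_trans ?_ (h k)
        simp_rw [← ENNReal.tsum_mul_left]
        rw [← Summable.tsum_finsetSum fun _ _ => ENNReal.summable]
        refine ENNReal.tsum_le_tsum fun j => ?_
        simp_rw [← mul_assoc]
        rw [← Finset.sum_mul]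
        gcongr
        exact ih j
  rw [tabooMeasure, ← ENNReal.tsum_mul_left, ENNReal.tsum_eq_iSup_nat]
  exact iSup_le fun n => partial_sum_le n j

theorem eq_zero_of_subinvariant_of_eq_zero (hirr : IsIrreducibleGenerator Q)
    (hdiag : ∀ j, Q j j < 0) {ν : E → ℝ≥0∞} (h : ∀ k, ∑' j, ν j * jumpProb Q j k ≤ ν k) {i : E}
    (hi : ν i = 0) (j : E) : ν j = 0 := by
  induction hirr j i using Relation.ReflTransGen.head_induction_on with
  | refl => exact hi
  | @head a c hac _ ih =>
    have hle : ν a * jumpProb Q a c ≤ 0 := ih ▸ (ENNReal.le_tsum a).trans (h c)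
    have hne : a ≠ c := by
      rintro rfl; exact (hdiag a).not_gt hac
    have hp : jumpProb Q a c ≠ 0 := by
      simp only [jumpProb, (hdiag a).ne, hne, if_false]
      exact (ENNReal.ofReal_pos.2 (div_pos hac (neg_pos.2 (hdiag a)))).ne'
    exact (mul_eq_zero.1 (le_bot_iff.1 hle)).resolve_right hp

/-- The excess of `ν` over `ν i • tabooMeasure Q i` is again subinvariant, and vanishes at `i`. -/
theorem eq_mul_tabooMeasure_of_subinvariant (hirr : IsIrreducibleGenerator Q)
    (hdiag : ∀ j, Q j j < 0) {i : E} (hret : returnProb Q i = 1) {ν : E → ℝ≥0∞}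
    (hfin : ∀ j, ν j ≠ ∞) (h : ∀ k, ∑' j, ν j * jumpProb Q j k ≤ ν k) (j : E) :
    ν j = ν i * tabooMeasure Q i j := by
  have hle := mul_tabooMeasure_le_of_subinvariant i h
  choose d hd using fun j => exists_add_of_le (hle j)
  have d_subinvariant : ∀ k, ∑' j, d j * jumpProb Q j k ≤ d k := by
    intro k
    have split : ∀ j, ν j * jumpProb Q j k
        = ν i * (tabooMeasure Q i j * jumpProb Q j k) + d j * jumpProb Q j k := fun j => by
      rw [hd j, add_mul, mul_assoc]
    have hk := h k
    rwa [tsum_congr split, ENNReal.tsum_add, ENNReal.tsum_mul_left, tabooMeasure_invariant hret,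
      hd k, ENNReal.add_le_add_iff_left (ne_top_of_le_ne_top (hfin k) (hle k))] at hk
  have d_self : d i = 0 := by
    have hi : ν i + 0 = ν i + d i := by simpa [tabooMeasure_self] using hd i
    exact ((ENNReal.add_right_inj (hfin i)).1 hi).symm
  rw [hd j, eq_zero_of_subinvariant_of_eq_zero hirr hdiag d_subinvariant d_self j, add_zero]

theorem tsum_ofReal_mul_jumpProb_le (hQ : IsGenerator Q) (hdiag : ∀ j, Q j j < 0) {m w : E → ℝ}
    (hm : ∀ j, 0 ≤ m j) (hmQ : HasVecMul m Q w) (hw : ∀ j, w j ≤ 0) (k : E) :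
    ∑' j, ENNReal.ofReal (-Q j j * m j) * jumpProb Q j k ≤ ENNReal.ofReal (-Q k k * m k) := by
  let f := Function.update (fun j => m j * Q j k) k 0
  have f_sum : HasSum f (0 - m k * Q k k + w k) := (hmQ k).update k 0
  have f_nonneg : ∀ j, 0 ≤ f j := fun j => by
    rcases eq_or_ne j k with rfl | hj
    · simp [f]
    · simpa [f, hj] using mul_nonneg (hm j) (hQ.1 j k hj)
  have f_eq : ∀ j, ENNReal.ofReal (-Q j j * m j) * jumpProb Q j k = ENNReal.ofReal (f j) := by
    intro j
    have hq : 0 < -Q j j := neg_pos.2 (hdiag j)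
    rcases eq_or_ne j k with rfl | hj
    · simp [f, jumpProb, (hdiag j).ne]
    · simp only [f, jumpProb, (hdiag j).ne, hj, if_false, ne_eq, not_false_eq_true,
        Function.update_of_ne]
      rw [← ENNReal.ofReal_mul (mul_nonneg hq.le (hm j)), mul_comm _ (m j), mul_assoc,
        mul_div_cancel₀ _ hq.ne']
  simp_rw [f_eq]
  rw [← ENNReal.ofReal_tsum_of_nonneg f_nonneg f_sum.summable, f_sum.tsum_eq]
  exact ENNReal.ofReal_le_ofReal (by linarith [hw k])

theorem eq_of_hasVecMul_nonpos (hQ : IsGenerator Q) (hirr : IsIrreducibleGenerator Q)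
    (hdiag : ∀ j, Q j j < 0) {i : E} (hret : returnProb Q i = 1) {m m' w w' : E → ℝ}
    (hm : ∀ j, 0 ≤ m j) (hm' : ∀ j, 0 ≤ m' j) (hmQ : HasVecMul m Q w) (hmQ' : HasVecMul m' Q w')
    (hw : ∀ j, w j ≤ 0) (hw' : ∀ j, w' j ≤ 0) (hi : m i = m' i) (j : E) : m j = m' j := by
  have eq_mul : ∀ {m w : E → ℝ}, (∀ j, 0 ≤ m j) → HasVecMul m Q w → (∀ j, w j ≤ 0) →
      ENNReal.ofReal (-Q j j * m j) = ENNReal.ofReal (-Q i i * m i) * tabooMeasure Q i j :=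
    fun hm hmQ hw => eq_mul_tabooMeasure_of_subinvariant hirr hdiag hret
      (fun _ => ENNReal.ofReal_ne_top) (tsum_ofReal_mul_jumpProb_le hQ hdiag hm hmQ hw) j
  have hq : 0 < -Q j j := neg_pos.2 (hdiag j)
  have heq := (eq_mul hm hmQ hw).trans (hi ▸ (eq_mul hm' hmQ' hw').symm)
  rw [ENNReal.ofReal_eq_ofReal_iff (mul_nonneg hq.le (hm j)) (mul_nonneg hq.le (hm' j))] at heq
  exact mul_left_cancel₀ hq.ne' heq

end Generators

/-! ### Block matrices -/

/-- Entrywise nonnegative matrices. -/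
def EntrywiseNonneg {I J : Type*} (M : Matrix I J ℝ) : Prop := ∀ a b, 0 ≤ M a b

namespace EntrywiseNonneg

variable {I J K : Type*}

theorem mul [Fintype J] {M : Matrix I J ℝ} {N : Matrix J K ℝ} (hM : EntrywiseNonneg M)
    (hN : EntrywiseNonneg N) : EntrywiseNonneg (M * N) := fun a c =>
  Finset.sum_nonneg fun b _ => mul_nonneg (hM a b) (hN b c)

theorem zero : EntrywiseNonneg (0 : Matrix I J ℝ) := fun _ _ => le_rfl

theorem one [DecidableEq I] : EntrywiseNonneg (1 : Matrix I I ℝ) := fun a b => by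
  rw [Matrix.one_apply]; split_ifs <;> norm_num

end EntrywiseNonneg

section BlockMatrices

variable {β γ : Type*}

theorem one_eq_blockMatrix [DecidableEq β] :
    (1 : Matrix (ℕ × β) (ℕ × β) ℝ) = blockMatrix fun i j => if i = j then 1 else 0 := by
  ext ⟨i, a⟩ ⟨j, b⟩
  by_cases hij : i = j <;> simp [blockMatrix, Matrix.one_apply, hij]

theorem entrywiseNonneg_blockMatrix {F : ℕ → ℕ → Matrix β β ℝ}
    (h : ∀ i j, EntrywiseNonneg (F i j)) : EntrywiseNonneg (blockMatrix F) :=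
  fun p q => h p.1 q.1 p.2 q.2

/-- The matrix with a single block column. -/
def blockColumn (H : ℕ → Matrix β γ ℝ) : Matrix (ℕ × β) γ ℝ := fun p c => H p.1 p.2 c

/-- The block in position `(i, j)` of the block tridiagonal matrix whose block row `i` is
`…, 0, L i, P i, U i, 0, …`, with `P i` on the diagonal; `L 0` is not used. -/
def tridiagBlock (L P U : ℕ → Matrix β β ℝ) (i j : ℕ) : Matrix β β ℝ :=
  if j = i then P i else if j = i + 1 then U i else if i = j + 1 then L i else 0

@[simp] theorem tridiagBlock_self (L P U : ℕ → Matrix β β ℝ) (i : ℕ) :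
    tridiagBlock L P U i i = P i := by simp [tridiagBlock]

@[simp] theorem tridiagBlock_succ_right (L P U : ℕ → Matrix β β ℝ) (i : ℕ) :
    tridiagBlock L P U i (i + 1) = U i := by simp [tridiagBlock]

@[simp] theorem tridiagBlock_succ_left (L P U : ℕ → Matrix β β ℝ) (i : ℕ) :
    tridiagBlock L P U (i + 1) i = L (i + 1) := by
  rw [tridiagBlock, if_neg (by lia), if_neg (by lia), if_pos rfl]

theorem transpose_blockMatrix_tridiagBlock (L P U : ℕ → Matrix β β ℝ) :
    (blockMatrix (tridiagBlock L P U)).transpose = blockMatrix (tridiagBlock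
      (fun i => (U (i - 1)).transpose) (fun i => (P i).transpose)
      fun i => (L (i + 1)).transpose) := by
  ext ⟨i, a⟩ ⟨j, b⟩
  simp only [Matrix.transpose_apply, blockMatrix, tridiagBlock]
  split_ifs <;> first | lia | (subst_vars; simp)

section Finiteness

variable [Finite β] {F : ℕ → ℕ → Matrix β β ℝ}

theorem rowFinite_blockMatrix (h : ∀ i j, i + 1 < j → F i j = 0) : RowFinite (blockMatrix F) := by
  rintro ⟨i, a⟩
  refine ((Set.finite_Iic (i + 1)).prod Set.finite_univ).subset fun q hq => ⟨?_, trivial⟩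
  by_contra hlt
  exact hq (congrFun₂ (h i q.1 (not_le.1 hlt)) a q.2)

theorem colFinite_blockMatrix (h : ∀ i j, j + 1 < i → F i j = 0) : ColFinite (blockMatrix F) :=
  rowFinite_blockMatrix (F := fun i j => (F j i).transpose) fun i j hij => by
    rw [h j i hij, Matrix.transpose_zero]

theorem rowFinite_tridiag (L P U : ℕ → Matrix β β ℝ) :
    RowFinite (blockMatrix (tridiagBlock L P U)) := rowFinite_blockMatrix fun i j hij => by
  rw [tridiagBlock, if_neg (by lia), if_neg (by lia), if_neg (by lia)]

theorem colFinite_tridiag (L P U : ℕ → Matrix β β ℝ) :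
    ColFinite (blockMatrix (tridiagBlock L P U)) := colFinite_blockMatrix fun i j hij => by
  rw [tridiagBlock, if_neg (by lia), if_neg (by lia), if_neg (by lia)]

theorem triangularlyExhausted_blockMatrix (h : ∀ i j, j < i → F i j = 0) :
    TriangularlyExhausted (blockMatrix F) := fun F₀ => by
  cases nonempty_fintype β
  obtain ⟨n, hn⟩ := (F₀.image Prod.fst).exists_nat_subset_range
  refine ⟨Finset.range n ×ˢ Finset.univ, fun p hp => ?_, fun r hr s hs => ?_⟩
  · simpa using hn (Finset.mem_image_of_mem Prod.fst hp)
  · have hlt : s.1 < r.1 := by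
      simp only [Finset.mem_product, Finset.mem_range, Finset.mem_univ, and_true] at hr hs
      lia
    exact congrFun₂ (h r.1 s.1 hlt) r.2 s.2

end Finiteness

variable [Fintype β]

theorem hasSum_of_levels {f : ℕ × β → ℝ} (s : Finset ℕ) (h : ∀ i ∉ s, ∀ b, f (i, b) = 0) :
    HasSum f (∑ i ∈ s, ∑ b, f (i, b)) := by
  rw [← Finset.sum_product']
  refine hasSum_sum_of_ne_finset_zero fun p hp => h p.1 (fun hs => hp ?_) p.2
  exact Finset.mem_product.2 ⟨hs, Finset.mem_univ _⟩

theorem hasMatMul_blockColumn {F : ℕ → ℕ → Matrix β β ℝ} {H K : ℕ → Matrix β γ ℝ}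
    (s : ℕ → Finset ℕ) (h : ∀ i, ∀ j ∉ s i, F i j = 0 ∨ H j = 0)
    (hK : ∀ i, ∑ j ∈ s i, F i j * H j = K i) :
    HasMatMul (blockMatrix F) (blockColumn H) (blockColumn K) := fun p c => by
  have hval : blockColumn K p c = ∑ j ∈ s p.1, ∑ b, F p.1 j p.2 b * H j b c := by
    rw [blockColumn, ← hK, Matrix.sum_apply]; rfl
  rw [hval]
  exact hasSum_of_levels (s p.1) fun j hj b => by
    rcases h p.1 j hj with h0 | h0 <;> simp [blockMatrix, blockColumn, h0]

theorem hasMatMul_tridiag_blockColumn {L P U : ℕ → Matrix β β ℝ} {H K : ℕ → Matrix β γ ℝ}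
    (h_zero : P 0 * H 0 + U 0 * H 1 = K 0)
    (h_succ : ∀ i, L (i + 1) * H i + P (i + 1) * H (i + 1) + U (i + 1) * H (i + 2) = K (i + 1)) :
    HasMatMul (blockMatrix (tridiagBlock L P U)) (blockColumn H) (blockColumn K) := by
  refine hasMatMul_blockColumn (fun i => {i - 1, i, i + 1}) (fun i j hj => Or.inl ?_) fun i => ?_
  · simp only [Finset.mem_insert, Finset.mem_singleton, not_or] at hj
    rw [tridiagBlock, if_neg (by lia), if_neg (by lia), if_neg (by lia)]
  · rcases i with _ | i
    · simpa using h_zero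
    · simp [← h_succ, add_assoc]

variable {L P U : ℕ → Matrix β β ℝ} {H K : ℕ → ℕ → Matrix β β ℝ}

theorem hasMatMul_tridiag_left (h_zero : ∀ k, P 0 * H 0 k + U 0 * H 1 k = K 0 k)
    (h_succ : ∀ i k,
      L (i + 1) * H i k + P (i + 1) * H (i + 1) k + U (i + 1) * H (i + 2) k = K (i + 1) k) :
    HasMatMul (blockMatrix (tridiagBlock L P U)) (blockMatrix H) (blockMatrix K) := fun p q =>
  hasMatMul_tridiag_blockColumn (H := fun i => H i q.1) (K := fun i => K i q.1) (h_zero q.1)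
    (fun i => h_succ i q.1) p q.2

theorem hasMatMul_tridiag_right (h_zero : ∀ i, H i 0 * P 0 + H i 1 * L 1 = K i 0)
    (h_succ : ∀ i k,
      H i k * U k + H i (k + 1) * P (k + 1) + H i (k + 2) * L (k + 2) = K i (k + 1)) :
    HasMatMul (blockMatrix H) (blockMatrix (tridiagBlock L P U)) (blockMatrix K) := by
  have h := hasMatMul_tridiag_left (H := fun i j => (H j i).transpose)
    (L := fun i => (U (i - 1)).transpose) (P := fun i => (P i).transpose)
    (U := fun i => (L (i + 1)).transpose) (K := fun i j => (K j i).transpose)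
    (fun k => by rw [← h_zero k]; simp) fun i k => by rw [← h_succ k i]; simp
  rw [← transpose_blockMatrix_tridiagBlock] at h
  exact h.transpose

theorem hasMatMul_blockDiagonal_right (F : ℕ → ℕ → Matrix β β ℝ) (E : ℕ → Matrix β β ℝ) :
    HasMatMul (blockMatrix F) (blockMatrix fun i j => if i = j then E i else 0)
      (blockMatrix fun i j => F i j * E j) := fun p q =>
  hasMatMul_blockColumn (H := fun i => if i = q.1 then E i else 0)
    (K := fun i => F i q.1 * E q.1) (fun _ => {q.1})
    (fun i j hj => Or.inr <| if_neg fun h => hj (by simp [h])) (fun i => by simp) p q.2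

theorem hasMatMul_blockDiagonal_left (E : ℕ → Matrix β β ℝ) (F : ℕ → ℕ → Matrix β β ℝ) :
    HasMatMul (blockMatrix fun i j => if i = j then E i else 0) (blockMatrix F)
      (blockMatrix fun i j => E i * F i j) := fun p q =>
  hasMatMul_blockColumn (H := fun i => F i q.1) (K := fun i => E i * F i q.1) (fun i => {i})
    (fun i j hj => Or.inl <| if_neg fun h => hj (by simp [h])) (fun i => by simp) p q.2

theorem hasMatMul_blockDiagonal_one [DecidableEq β] {E E' : ℕ → Matrix β β ℝ}
    (h : ∀ i, E i * E' i = 1) :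
    HasMatMul (blockMatrix fun i j => if i = j then E i else 0)
      (blockMatrix fun i j => if i = j then E' i else 0) 1 := by
  rw [one_eq_blockMatrix]
  convert hasMatMul_blockDiagonal_left E _ using 2
  ext1 i; ext1 j
  split_ifs <;> subst_vars <;> simp [h]

theorem hasMatMul_tridiag_diagonal {L P U L' P' U' E : ℕ → Matrix β β ℝ}
    (hL : ∀ i, L (i + 1) * E i = L' (i + 1)) (hP : ∀ i, P i * E i = P' i)
    (hU : ∀ i, U i * E (i + 1) = U' i) :
    HasMatMul (blockMatrix (tridiagBlock L P U)) (blockMatrix fun i j => if i = j then E i else 0)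
      (blockMatrix (tridiagBlock L' P' U')) := by
  convert hasMatMul_blockDiagonal_right _ E using 2
  ext1 i; ext1 j
  unfold tridiagBlock
  split_ifs <;> subst_vars <;> simp [*]

theorem hasMatMul_diagonal_tridiag {L P U L' P' U' E : ℕ → Matrix β β ℝ}
    (hL : ∀ i, E (i + 1) * L (i + 1) = L' (i + 1)) (hP : ∀ i, E i * P i = P' i)
    (hU : ∀ i, E i * U i = U' i) :
    HasMatMul (blockMatrix fun i j => if i = j then E i else 0) (blockMatrix (tridiagBlock L P U))
      (blockMatrix (tridiagBlock L' P' U')) := by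
  convert hasMatMul_blockDiagonal_left E _ using 2
  ext1 i; ext1 j
  unfold tridiagBlock
  split_ifs <;> subst_vars <;> simp [*]

end BlockMatrices

/-! ### The RG-factorization -/

namespace LDQBD

variable {α β : Type*}

theorem Qhat_eq_tridiag (D : LDQBD α β) :
    D.Qhat = blockMatrix (tridiagBlock (fun i => D.A2 (i + 1)) (fun i => D.A1 (i + 1))
      fun i => D.A0 (i + 1)) := rfl

theorem rowFinite_Qhat [Finite β] (D : LDQBD α β) : RowFinite D.Qhat := rowFinite_tridiag _ _ _

theorem colFinite_Qhat [Finite β] (D : LDQBD α β) : ColFinite D.Qhat := colFinite_tridiag _ _ _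

variable [Fintype β] [DecidableEq β] {D : LDQBD α β}

section Measures

theorem Psi_mul_inv {k : ℕ} (hu : IsUnit (D.Psi k)) : D.Psi k * (D.Psi k)⁻¹ = 1 :=
  Matrix.mul_nonsing_inv _ ((D.Psi k).isUnit_iff_isUnit_det.1 hu)

theorem Psi_inv_mul {k : ℕ} (hu : IsUnit (D.Psi k)) : (D.Psi k)⁻¹ * D.Psi k = 1 :=
  Matrix.nonsing_inv_mul _ ((D.Psi k).isUnit_iff_isUnit_det.1 hu)

theorem Psi_mul_G {k : ℕ} (hu : IsUnit (D.Psi k)) : D.Psi k * D.G k = -D.A0 (k + 1) := by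
  rw [G, ← mul_assoc, mul_neg, Psi_mul_inv hu, neg_one_mul]

theorem R_succ_mul_Psi {k : ℕ} (hu : IsUnit (D.Psi k)) :
    D.R (k + 1) * D.Psi k = -D.A2 (k + 2) := by
  rw [R, mul_assoc, neg_mul, Psi_inv_mul hu, mul_neg_one]

variable (D)

theorem A1_add_A2_mul_G (k : ℕ) : D.A1 (k + 2) + D.A2 (k + 2) * D.G k = D.Psi (k + 1) := by
  rw [Psi, G, mul_assoc]

theorem R_mul_A0_add_A1 (k : ℕ) : D.R (k + 1) * D.A0 (k + 1) + D.A1 (k + 2) = D.Psi (k + 1) := by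
  rw [Psi, R, add_comm]

theorem R_recursion (k : ℕ) :
    D.R (k + 2) = -(D.A2 (k + 3) * (D.R (k + 1) * D.A0 (k + 1) + D.A1 (k + 2))⁻¹) := by
  rw [R_mul_A0_add_A1, R, mul_neg]

theorem G_recursion (k : ℕ) :
    D.G (k + 1) = -((D.A1 (k + 2) + D.A2 (k + 2) * D.G k)⁻¹ * D.A0 (k + 2)) := by
  rw [A1_add_A2_mul_G, G, neg_mul]

variable {D}

theorem isNonnegRSolution_R (hu : ∀ k, IsUnit (D.Psi k))
    (hnn : ∀ k, EntrywiseNonneg (D.R (k + 1))) : D.IsNonnegRSolution D.R := by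
  refine ⟨fun k hk => ?_, rfl, fun k hk => ?_⟩ <;> obtain ⟨k, rfl⟩ := Nat.exists_eq_add_of_le' hk
  · exact hnn k
  · rw [mul_assoc, ← mul_add, R_mul_A0_add_A1, R_succ_mul_Psi (hu _), neg_add_cancel]

theorem isNonnegGSolution_G (hu : ∀ k, IsUnit (D.Psi k)) (hnn : ∀ k, EntrywiseNonneg (D.G k)) :
    D.IsNonnegGSolution D.G := by
  refine ⟨hnn, rfl, fun k hk => ?_⟩
  obtain ⟨k, rfl⟩ := Nat.exists_eq_add_of_le' hk
  rw [add_assoc, ← add_mul, Nat.add_sub_cancel, A1_add_A2_mul_G, Psi_mul_G (hu _), add_neg_cancel]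

namespace IsNonnegRSolution

theorem succ_eq_R (hu : ∀ k, IsUnit (D.Psi k)) {S : ℕ → Matrix β β ℝ}
    (hS : D.IsNonnegRSolution S) (k : ℕ) : S (k + 1) = D.R (k + 1) := by
  induction k with
  | zero => exact hS.2.1
  | succ k ih =>
    have heq := hS.2.2 (k + 1) (by simp)
    rw [ih, mul_assoc, ← mul_add, R_mul_A0_add_A1] at heq
    refine (hu (k + 1)).mul_right_cancel ?_
    rw [R_succ_mul_Psi (hu _), eq_neg_of_add_eq_zero_left heq]

end IsNonnegRSolution

namespace IsNonnegGSolution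

theorem eq_G (hu : ∀ k, IsUnit (D.Psi k)) {S : ℕ → Matrix β β ℝ}
    (hS : D.IsNonnegGSolution S) : S = D.G := by
  ext1 k
  induction k with
  | zero => exact hS.2.1
  | succ k ih =>
    have heq := hS.2.2 (k + 1) (by simp)
    rw [Nat.add_sub_cancel, ih, add_assoc, ← add_mul, A1_add_A2_mul_G] at heq
    refine (hu (k + 1)).mul_left_cancel ?_
    rw [Psi_mul_G (hu _), eq_neg_of_add_eq_zero_right heq]

end IsNonnegGSolution

end Measures

section UnipotentFactors

variable (D)

/-- The block of `(I - 𝔾_U)⁻¹` in position `(i, j)`. -/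
noncomputable def GUinvBlock (i j : ℕ) : Matrix β β ℝ := if i ≤ j then D.Y i (j - i) else 0

/-- The block of `(I - ℝ_L)⁻¹` in position `(i, j)`. -/
noncomputable def RLinvBlock (i j : ℕ) : Matrix β β ℝ := if j ≤ i then D.X i (i - j) else 0

theorem Y_succ_eq_G_mul (l k : ℕ) : D.Y l (k + 1) = D.G l * D.Y (l + 1) k := by
  induction k with
  | zero => simp [Y]
  | succ k ih => rw [Y, ih, Y, mul_assoc, show l + (k + 1) = l + 1 + k by ring]

theorem X_succ_eq_R_mul (l k : ℕ) : D.X (l + 1) (k + 1) = D.R (l + 1) * D.X l k := by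
  induction k with
  | zero => simp [X]
  | succ k ih => rw [X, ih, X, mul_assoc, Nat.add_sub_add_right]

theorem GUinvBlock_of_lt {i j : ℕ} (h : j < i) : D.GUinvBlock i j = 0 := if_neg h.not_ge

theorem RLinvBlock_of_lt {i j : ℕ} (h : i < j) : D.RLinvBlock i j = 0 := if_neg h.not_ge

@[simp] theorem GUinvBlock_self (i : ℕ) : D.GUinvBlock i i = 1 := by simp [GUinvBlock, Y]

@[simp] theorem RLinvBlock_self (i : ℕ) : D.RLinvBlock i i = 1 := by simp [RLinvBlock, X]

theorem GUinvBlock_sub_G_mul (i j : ℕ) :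
    D.GUinvBlock i j - D.G i * D.GUinvBlock (i + 1) j = if i = j then 1 else 0 := by
  rcases Nat.lt_trichotomy i j with h | rfl | h
  · obtain ⟨d, rfl⟩ := Nat.exists_eq_add_of_le' h
    rw [if_neg h.ne, sub_eq_zero, GUinvBlock, GUinvBlock, if_pos h.le, if_pos (by lia),
      show d + i.succ - i = d + 1 by lia, show d + i.succ - (i + 1) = d by lia, Y_succ_eq_G_mul]
  · simp [GUinvBlock_of_lt]
  · simp [GUinvBlock_of_lt, h, h.ne', h.trans (Nat.lt_succ_self i)]

theorem GUinvBlock_succ_sub_mul_G (i j : ℕ) :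
    D.GUinvBlock i (j + 1) - D.GUinvBlock i j * D.G j = if i = j + 1 then 1 else 0 := by
  rcases Nat.lt_trichotomy i (j + 1) with h | rfl | h
  · obtain ⟨d, rfl⟩ := Nat.exists_eq_add_of_le (Nat.lt_succ_iff.1 h)
    rw [if_neg h.ne, sub_eq_zero, GUinvBlock, GUinvBlock, if_pos h.le, if_pos (by lia),
      show i + d + 1 - i = d + 1 by lia, Nat.add_sub_cancel_left, Y]
  · simp [GUinvBlock_of_lt]
  · simp [GUinvBlock_of_lt, h, h.ne', (Nat.lt_succ_self j).trans h]

theorem RLinvBlock_sub_mul_R (i j : ℕ) :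
    D.RLinvBlock i j - D.RLinvBlock i (j + 1) * D.R (j + 1) = if i = j then 1 else 0 := by
  rcases Nat.lt_trichotomy j i with h | rfl | h
  · obtain ⟨d, rfl⟩ := Nat.exists_eq_add_of_le' h
    rw [if_neg h.ne', sub_eq_zero, RLinvBlock, RLinvBlock, if_pos h.le, if_pos (by lia),
      show d + j.succ - j = d + 1 by lia, show d + j.succ - (j + 1) = d by lia, X,
      Nat.add_sub_cancel_left]
  · simp [RLinvBlock_of_lt]
  · simp [RLinvBlock_of_lt, h, h.ne, h.trans (Nat.lt_succ_self j)]

theorem RLinvBlock_succ_sub_R_mul (i j : ℕ) :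
    D.RLinvBlock (i + 1) j - D.R (i + 1) * D.RLinvBlock i j = if i + 1 = j then 1 else 0 := by
  rcases Nat.lt_trichotomy j (i + 1) with h | rfl | h
  · obtain ⟨d, rfl⟩ := Nat.exists_eq_add_of_le (Nat.lt_succ_iff.1 h)
    rw [if_neg h.ne', sub_eq_zero, RLinvBlock, RLinvBlock, if_pos h.le, if_pos (by lia),
      show j + d + 1 - j = d + 1 by lia, Nat.add_sub_cancel_left, X_succ_eq_R_mul]
  · simp [RLinvBlock_of_lt]
  · simp [RLinvBlock_of_lt, h, h.ne, (Nat.lt_succ_self i).trans h]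

theorem one_sub_GU_eq_tridiag :
    1 - D.GU = blockMatrix (tridiagBlock 0 (fun _ => 1) fun i => -D.G i) := by
  rw [one_eq_blockMatrix]
  ext ⟨i, a⟩ ⟨j, b⟩
  simp only [GU, blockMatrix, tridiagBlock, Matrix.sub_apply]
  split_ifs <;> first | lia | simp

theorem one_sub_RL_eq_tridiag :
    1 - D.RL = blockMatrix (tridiagBlock (fun i => -D.R i) (fun _ => 1) 0) := by
  rw [one_eq_blockMatrix]
  ext ⟨i, a⟩ ⟨j, b⟩
  simp only [RL, blockMatrix, tridiagBlock, Matrix.sub_apply]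
  split_ifs <;> first | lia | simp

theorem isMatInverse_one_sub_GU : IsMatInverse (1 - D.GU) D.GUinv := by
  rw [IsMatInverse, one_sub_GU_eq_tridiag, one_eq_blockMatrix]
  constructor
  · refine hasMatMul_tridiag_left (H := D.GUinvBlock) (fun k => ?_) fun i k => ?_
    · simpa [sub_eq_add_neg] using D.GUinvBlock_sub_G_mul 0 k
    · simpa [sub_eq_add_neg] using D.GUinvBlock_sub_G_mul (i + 1) k
  · refine hasMatMul_tridiag_right (H := D.GUinvBlock) (fun i => ?_) fun i k => ?_
    · rcases i with _ | i <;> simp [GUinvBlock_of_lt]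
    · simpa [sub_eq_neg_add] using D.GUinvBlock_succ_sub_mul_G i k

theorem isMatInverse_one_sub_RL : IsMatInverse (1 - D.RL) D.RLinv := by
  rw [IsMatInverse, one_sub_RL_eq_tridiag, one_eq_blockMatrix]
  constructor
  · refine hasMatMul_tridiag_left (H := D.RLinvBlock) (fun k => ?_) fun i k => ?_
    · rcases k with _ | k <;> simp [RLinvBlock_of_lt]
    · simpa [sub_eq_neg_add] using D.RLinvBlock_succ_sub_R_mul i k
  · refine hasMatMul_tridiag_right (H := D.RLinvBlock) (fun i => ?_) fun i k => ?_
    · simpa [sub_eq_add_neg] using D.RLinvBlock_sub_mul_R i 0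
    · simpa [sub_eq_add_neg] using D.RLinvBlock_sub_mul_R i (k + 1)

end UnipotentFactors

section Factorization

variable (D)

/-- `(I - ℝ_L) 𝕌_D`, the block lower triangular factor of `Q̂`. -/
noncomputable def lowerFactor : Matrix (ℕ × β) (ℕ × β) ℝ :=
  blockMatrix (tridiagBlock (fun i => D.A2 (i + 1)) D.Psi 0)

/-- `𝕌_D (I - 𝔾_U)`, the block upper triangular factor of `Q̂`. -/
noncomputable def upperFactor : Matrix (ℕ × β) (ℕ × β) ℝ :=
  blockMatrix (tridiagBlock 0 D.Psi fun i => D.A0 (i + 1))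

/-- `(I - 𝔾_U)⁻¹ 𝕌_D⁻¹`, the inverse of `upperFactor`. -/
noncomputable def upperFactorInv : Matrix (ℕ × β) (ℕ × β) ℝ :=
  blockMatrix fun i j => D.GUinvBlock i j * (D.Psi j)⁻¹

theorem rowFinite_RLinv : RowFinite D.RLinv :=
  rowFinite_blockMatrix fun _ _ h => D.RLinvBlock_of_lt (by lia)

theorem GUinv_mul_UDinv : HasMatMul D.GUinv D.UDinv D.upperFactorInv :=
  hasMatMul_blockDiagonal_right _ _

theorem colFinite_upperFactorInv : ColFinite D.upperFactorInv :=
  colFinite_blockMatrix fun _ _ h => by rw [D.GUinvBlock_of_lt (by lia), zero_mul]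

theorem triangularlyExhausted_upperFactor : TriangularlyExhausted D.upperFactor :=
  triangularlyExhausted_blockMatrix fun _ _ h => by
    rw [tridiagBlock, if_neg (by lia), if_neg (by lia), Pi.zero_apply, ite_self]

theorem triangularlyExhausted_transpose_one_sub_RL :
    TriangularlyExhausted (1 - D.RL).transpose := by
  rw [one_sub_RL_eq_tridiag, transpose_blockMatrix_tridiagBlock]
  refine triangularlyExhausted_blockMatrix fun i j h => ?_
  rw [tridiagBlock, if_neg (by lia), if_neg (by lia), Pi.zero_apply, Matrix.transpose_zero,
    ite_self]

variable {D}

theorem Psi_mul_GUinvBlock_add {i l : ℕ} (hu : i < l → IsUnit (D.Psi i)) :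
    D.Psi i * D.GUinvBlock i l + D.A0 (i + 1) * D.GUinvBlock (i + 1) l =
      if i = l then D.Psi i else 0 := by
  have hsub := D.GUinvBlock_sub_G_mul i l
  rcases Nat.lt_trichotomy i l with h | rfl | h
  · rw [if_neg h.ne, sub_eq_zero] at hsub
    rw [if_neg h.ne, hsub, ← mul_assoc, Psi_mul_G (hu h), neg_mul, neg_add_cancel]
  · simp [GUinvBlock_of_lt]
  · simp [GUinvBlock_of_lt, h, h.ne', h.trans (Nat.lt_succ_self i)]

/-- Column `l` only involves `Ψ_0, …, Ψ_{l-1}`, so it is available before the invertibility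
of `Ψ_l` is known. -/
theorem Qhat_mul_GUinv_column {l : ℕ} (hu : ∀ k < l, IsUnit (D.Psi k)) :
    HasMatMul D.Qhat (blockColumn fun i => D.GUinvBlock i l)
      (blockColumn fun i => tridiagBlock (fun i => D.A2 (i + 1)) D.Psi 0 i l) := by
  refine hasMatMul_tridiag_blockColumn ?_ fun i => ?_
  · refine (Psi_mul_GUinvBlock_add (hu 0)).trans ?_
    rcases l with _ | l <;> simp [tridiagBlock]
  · have hsub := D.GUinvBlock_sub_G_mul i l
    have hPsi := Psi_mul_GUinvBlock_add (hu (i + 1))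
    calc D.A2 (i + 2) * D.GUinvBlock i l + D.A1 (i + 2) * D.GUinvBlock (i + 1) l
          + D.A0 (i + 2) * D.GUinvBlock (i + 2) l
        = D.A2 (i + 2) * (D.GUinvBlock i l - D.G i * D.GUinvBlock (i + 1) l)
          + (D.Psi (i + 1) * D.GUinvBlock (i + 1) l
            + D.A0 (i + 2) * D.GUinvBlock (i + 2) l) := by
          rw [← A1_add_A2_mul_G]; noncomm_ring
      _ = _ := by
          rw [hsub, hPsi, tridiagBlock]
          split_ifs <;> first | lia | simp

variable (hu : ∀ k, IsUnit (D.Psi k))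
include hu

theorem isMatInverse_UD : IsMatInverse D.UD D.UDinv :=
  ⟨hasMatMul_blockDiagonal_one fun i => Psi_mul_inv (hu i),
    hasMatMul_blockDiagonal_one fun i => Psi_inv_mul (hu i)⟩

theorem one_sub_RL_mul_UD : HasMatMul (1 - D.RL) D.UD D.lowerFactor := by
  rw [one_sub_RL_eq_tridiag]
  exact hasMatMul_tridiag_diagonal (fun i => by simp [R_succ_mul_Psi (hu i)]) (by simp) (by simp)

theorem UD_mul_one_sub_GU : HasMatMul D.UD (1 - D.GU) D.upperFactor := by
  rw [one_sub_GU_eq_tridiag]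
  exact hasMatMul_diagonal_tridiag (by simp) (by simp) fun i => by simp [Psi_mul_G (hu i)]

theorem lowerFactor_mul_UDinv : HasMatMul D.lowerFactor D.UDinv (1 - D.RL) := by
  rw [one_sub_RL_eq_tridiag]
  exact hasMatMul_tridiag_diagonal (fun i => by simp [R]) (fun i => Psi_mul_inv (hu i)) (by simp)

theorem UDinv_mul_upperFactor : HasMatMul D.UDinv D.upperFactor (1 - D.GU) := by
  rw [one_sub_GU_eq_tridiag]
  exact hasMatMul_diagonal_tridiag (by simp) (fun i => Psi_inv_mul (hu i)) fun i => by simp [G]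

theorem Qhat_mul_GUinv : HasMatMul D.Qhat D.GUinv D.lowerFactor := fun p q =>
  Qhat_mul_GUinv_column (fun k _ => hu k) p q.2

theorem lowerFactor_mul_one_sub_GU : HasMatMul D.lowerFactor (1 - D.GU) D.Qhat :=
  (HasMatMul.assoc_of_rowFinite D.rowFinite_Qhat (Qhat_mul_GUinv hu)
    D.isMatInverse_one_sub_GU.2).2 (.one_right _)

theorem Qhat_factorization : HasMatMul₃ (1 - D.RL) D.UD (1 - D.GU) D.Qhat :=
  ⟨D.lowerFactor, one_sub_RL_mul_UD hu, lowerFactor_mul_one_sub_GU hu⟩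

theorem RLinv_mul_lowerFactor : HasMatMul D.RLinv D.lowerFactor D.UD :=
  (HasMatMul.assoc_of_rowFinite D.rowFinite_RLinv D.isMatInverse_one_sub_RL.2
    (one_sub_RL_mul_UD hu)).1 (.one_left _)

theorem RLinv_mul_Qhat : HasMatMul D.RLinv D.Qhat D.upperFactor :=
  (HasMatMul.assoc_of_rowFinite D.rowFinite_RLinv (RLinv_mul_lowerFactor hu)
    (lowerFactor_mul_one_sub_GU hu)).1 (UD_mul_one_sub_GU hu)

theorem Qhat_mul_upperFactorInv : HasMatMul D.Qhat D.upperFactorInv (1 - D.RL) :=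
  (HasMatMul.assoc_of_rowFinite D.rowFinite_Qhat (Qhat_mul_GUinv hu)
    D.GUinv_mul_UDinv).1 (lowerFactor_mul_UDinv hu)

theorem upperFactorInv_mul_upperFactor : HasMatMul D.upperFactorInv D.upperFactor 1 :=
  (HasMatMul.assoc_of_colFinite (colFinite_tridiag _ _ _) D.GUinv_mul_UDinv
    (UDinv_mul_upperFactor hu)).2 D.isMatInverse_one_sub_GU.2

theorem isMatInverse_Qhat_of_upperFactorInv_mul {V : Matrix (ℕ × β) (ℕ × β) ℝ}
    (hV : HasMatMul D.upperFactorInv D.RLinv V) : IsMatInverse D.Qhat V :=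
  ⟨(HasMatMul.assoc_of_rowFinite D.rowFinite_Qhat (Qhat_mul_upperFactorInv hu) hV).1
    D.isMatInverse_one_sub_RL.1,
  (HasMatMul.assoc_of_colFinite D.colFinite_Qhat hV (RLinv_mul_Qhat hu)).2
    (upperFactorInv_mul_upperFactor hu)⟩

end Factorization

end LDQBD

/-! ### Nonnegativity of the blocks `-Ψ⁻¹`, `𝐑` and `𝐆` -/

theorem hasSum_sumType_iff {α γ : Type*} {f : α ⊕ γ → ℝ} {s t : ℝ}
    (hs : HasSum (fun a => f (Sum.inl a)) s) :
    HasSum f (s + t) ↔ HasSum (fun c => f (Sum.inr c)) t := by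
  refine ⟨fun h => ?_, hs.sum⟩
  have h_inr := (h.summable.comp_injective Sum.inr_injective).hasSum
  rwa [add_left_cancel ((HasSum.sum hs h_inr).unique h)] at h_inr

namespace LDQBD

section Signs

variable {α β : Type*} {D : LDQBD α β}

section Blocks

variable (hgen : IsGenerator D.generator)
include hgen

theorem Qhat_offDiag_nonneg {p q : ℕ × β} (hpq : p ≠ q) : 0 ≤ D.Qhat p q :=
  hgen.1 (Sum.inr p) (Sum.inr q) (Sum.inr_injective.ne hpq)

theorem A0_nonneg (k : ℕ) : EntrywiseNonneg (D.A0 (k + 1)) := fun a b => by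
  simpa [Qhat_eq_tridiag, blockMatrix] using
    Qhat_offDiag_nonneg hgen (p := (k, a)) (q := (k + 1, b)) (by simp)

theorem A2_nonneg (k : ℕ) : EntrywiseNonneg (D.A2 (k + 2)) := fun a b => by
  simpa [Qhat_eq_tridiag, blockMatrix] using
    Qhat_offDiag_nonneg hgen (p := (k + 1, a)) (q := (k, b)) (by simp)

theorem A1_offDiag_nonneg (k : ℕ) {a b : β} (hab : a ≠ b) : 0 ≤ D.A1 (k + 1) a b := by
  simpa [Qhat_eq_tridiag, blockMatrix] using
    Qhat_offDiag_nonneg hgen (p := (k, a)) (q := (k, b)) (by simpa using hab)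

variable [Fintype β] [DecidableEq β]

section

variable {k : ℕ} (hN : EntrywiseNonneg (-(D.Psi k)⁻¹))
include hN

theorem G_nonneg : EntrywiseNonneg (D.G k) := hN.mul (A0_nonneg hgen k)

theorem R_succ_nonneg : EntrywiseNonneg (D.R (k + 1)) := (A2_nonneg hgen k).mul hN

end

variable (hN : ∀ k, EntrywiseNonneg (-(D.Psi k)⁻¹))
include hN

theorem Psi_offDiag_nonneg (k : ℕ) {a b : β} (hab : a ≠ b) : 0 ≤ D.Psi k a b := by
  rcases k with _ | k
  · exact A1_offDiag_nonneg hgen 0 hab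
  · rw [← A1_add_A2_mul_G]
    exact add_nonneg (A1_offDiag_nonneg hgen (k + 1) hab)
      ((A2_nonneg hgen k).mul (G_nonneg hgen (hN k)) a b)

theorem GUinvBlock_nonneg (i j : ℕ) : EntrywiseNonneg (D.GUinvBlock i j) := by
  have hY : ∀ k, EntrywiseNonneg (D.Y i k) := fun k => by
    induction k with
    | zero => exact .one
    | succ k ih => exact ih.mul (G_nonneg hgen (hN _))
  rw [GUinvBlock]
  split_ifs
  exacts [hY _, .zero]

theorem R_nonneg : ∀ l, EntrywiseNonneg (D.R l)
  | 0 => .zero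
  | l + 1 => R_succ_nonneg hgen (hN l)

theorem one_sub_RL_offDiag_nonpos {p q : ℕ × β} (hpq : p ≠ q) : (1 - D.RL) p q ≤ 0 := by
  have hRL : 0 ≤ D.RL p q := by
    simp only [RL, blockMatrix]
    split_ifs
    exacts [R_nonneg hgen hN _ _ _, le_rfl]
  rw [Matrix.sub_apply, Matrix.one_apply_ne hpq, zero_sub]
  exact neg_nonpos.2 hRL

theorem RLinv_nonneg : EntrywiseNonneg D.RLinv := entrywiseNonneg_blockMatrix fun i j => by
  have hX : ∀ k, EntrywiseNonneg (D.X i k) := fun k => by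
    induction k with
    | zero => exact .one
    | succ k ih => exact ih.mul (R_nonneg hgen hN _)
  split_ifs
  exacts [hX _, .zero]

theorem neg_upperFactorInv_nonneg : EntrywiseNonneg (-D.upperFactorInv) := fun p q => by
  have h := (GUinvBlock_nonneg hgen hN p.1 q.1).mul (hN q.1) p.2 q.2
  rwa [mul_neg] at h

theorem upperFactor_offDiag_nonneg {p q : ℕ × β} (hpq : p ≠ q) : 0 ≤ D.upperFactor p q := by
  obtain ⟨i, a⟩ := p
  obtain ⟨j, b⟩ := q
  simp only [upperFactor, blockMatrix, tridiagBlock]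
  split_ifs with h
  · exact Psi_offDiag_nonneg hgen hN i fun hab => hpq (by rw [h, hab])
  · exact A0_nonneg hgen i a b
  all_goals exact le_rfl

end Blocks

section MinimumPrinciple

variable [Nonempty α] [Fintype β] [DecidableEq β] (hgen : IsGenerator D.generator)
  (hirr : IsIrreducibleGenerator D.generator)
include hgen hirr

/-- `w` extends to the vector `(I - 𝔾_U)⁻¹ (0, …, 0, w, 0, …)`, on which `Q̂` is `Ψ_l w` in level
`l` and `0` below it. -/
theorem nonneg_of_Psi_mulVec_nonpos {l : ℕ} (hu : ∀ k < l, IsUnit (D.Psi k)) {w : β → ℝ}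
    (hw : ∀ b, (D.Psi l).mulVec w b ≤ 0) (b : β) : 0 ≤ w b := by
  let H : Matrix (ℕ × β) β ℝ := blockColumn fun i => D.GUinvBlock i l
  let u : α ⊕ ℕ × β → ℝ := Sum.elim 0 (H.mulVec w)
  have u_above : ∀ i b, l < i → u (Sum.inr (i, b)) = 0 := fun i b hi => by
    have hH : H (i, b) = 0 := by
      ext c; simp [H, blockColumn, GUinvBlock_of_lt, hi]
    simp [u, Matrix.mulVec, hH]
  have hfin : u.support.Finite := by
    refine (((Set.finite_Iic l).prod (Set.finite_univ (α := β))).image Sum.inr).subset ?_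
    rintro (a | ⟨i, b⟩) hi
    · exact absurd rfl hi
    · exact ⟨(i, b), ⟨not_lt.1 fun h => hi (u_above i b h), trivial⟩, rfl⟩
  have hu_rows : ∀ i, u i < 0 → ∃ s ≤ 0, HasSum (fun j => D.generator i j * u j) s := by
    rintro (a | ⟨i, b⟩) hi
    · exact absurd hi (lt_irrefl _)
    · have hil : i ≤ l := not_lt.1 fun h => hi.ne (u_above i b h)
      have row_sum := (hasSum_sumType_iff (f := fun j => D.generator (Sum.inr (i, b)) j * u j)
        (s := 0) (by simp [u])).2 ((Qhat_mul_GUinv_column hu).hasSum_mulVec w (i, b))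
      refine ⟨_, ?_, row_sum⟩
      rcases hil.eq_or_lt with rfl | hil
      · simpa [u, Matrix.mulVec, blockColumn] using hw b
      · simp [Matrix.mulVec, blockColumn, tridiagBlock, hil.ne', (Nat.lt_succ_of_lt hil).ne]
  have hnn := hirr.nonneg_of_mulVec_nonpos hgen hfin (z := Sum.inl (Classical.arbitrary α)) rfl
    hu_rows (Sum.inr (l, b))
  have u_level : u (Sum.inr (l, b)) = (1 : Matrix β β ℝ).mulVec w b := by
    simp [u, H, Matrix.mulVec, blockColumn]
  rwa [u_level, Matrix.one_mulVec] at hnn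

theorem isUnit_Psi (l : ℕ) : IsUnit (D.Psi l) := by
  induction l using Nat.strong_induction_on with
  | _ l ih =>
    rw [← Matrix.mulVec_injective_iff_isUnit]
    have le_of_eq : ∀ v w, (D.Psi l).mulVec v = (D.Psi l).mulVec w → v ≤ w := fun v w h b =>
      sub_nonneg.1 <| nonneg_of_Psi_mulVec_nonpos hgen hirr ih (w := w - v)
        (fun c => by simp [Matrix.mulVec_sub, h]) b
    exact fun v w h => (le_of_eq v w h).antisymm (le_of_eq w v h.symm)

theorem neg_Psi_inv_nonneg (l : ℕ) : EntrywiseNonneg (-(D.Psi l)⁻¹) := fun a b => by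
  refine nonneg_of_Psi_mulVec_nonpos hgen hirr (l := l) (w := fun a => (-(D.Psi l)⁻¹) a b)
    (fun k _ => isUnit_Psi hgen hirr k) (fun c => ?_) a
  have h : D.Psi l * -(D.Psi l)⁻¹ = -1 := by rw [mul_neg, Psi_mul_inv (isUnit_Psi hgen hirr l)]
  refine (congrFun₂ h c b).trans_le (neg_nonpos.2 (EntrywiseNonneg.one c b))

end MinimumPrinciple

end Signs

end LDQBD

/-! ### The maximal nonpositive inverse -/

namespace LDQBD

section MaximalInverse

variable {α β : Type*} {D : LDQBD α β}

variable (D) in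
/-- The rates of the transitions into level `0`, as a column vector. -/
noncomputable def rateToLevelZero : Matrix (ℕ × β) Unit ℝ :=
  fun p _ => ∑' a, D.generator (Sum.inr p) (Sum.inl a)

section Generator

variable (hgen : IsGenerator D.generator)
include hgen

theorem rateToLevelZero_nonneg : EntrywiseNonneg D.rateToLevelZero :=
  fun _ _ => tsum_nonneg fun _ => hgen.1 _ _ Sum.inr_ne_inl

theorem hasSum_rateToLevelZero (p : ℕ × β) :
    HasSum (fun a => D.generator (Sum.inr p) (Sum.inl a)) (D.rateToLevelZero p ()) :=
  ((hgen.2 (Sum.inr p)).summable.comp_injective Sum.inl_injective).hasSum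

theorem Qhat_mul_ones : HasMatMul D.Qhat (fun _ _ => 1) (-D.rateToLevelZero) := fun p _ => by
  have h := hgen.2 (Sum.inr p)
  rw [← add_neg_cancel (D.rateToLevelZero p ()),
    hasSum_sumType_iff (hasSum_rateToLevelZero hgen p)] at h
  simp only [mul_one]
  exact h

end Generator

variable [Fintype β] [DecidableEq β]

variable (D) in
/-- The inverse `(I - 𝔾_U)⁻¹ 𝕌_D⁻¹ (I - ℝ_L)⁻¹` of `Q̂`. -/
noncomputable def Qinv : Matrix (ℕ × β) (ℕ × β) ℝ :=
  fun p q => ∑' r, D.upperFactorInv p r * D.RLinv r q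

variable [Nonempty α] (hgen : IsGenerator D.generator)
  (hirr : IsIrreducibleGenerator D.generator)
include hgen hirr

theorem exists_nonneg_upperFactor_mul_ones : ∃ K : Matrix (ℕ × β) Unit ℝ, EntrywiseNonneg K ∧
    HasMatMul D.RLinv D.rateToLevelZero K ∧ HasMatMul D.upperFactor (fun _ _ => 1) (-K) := by
  obtain ⟨K, hK⟩ := HasMatMul.exists_of_rowFinite D.rowFinite_RLinv D.rateToLevelZero
  exact ⟨K, fun p c => (hK p c).nonneg fun r =>
      mul_nonneg (RLinv_nonneg hgen (neg_Psi_inv_nonneg hgen hirr) p r)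
        (rateToLevelZero_nonneg hgen r c),
    hK, (HasMatMul.assoc_of_rowFinite D.rowFinite_RLinv (RLinv_mul_Qhat (isUnit_Psi hgen hirr))
      (Qhat_mul_ones hgen)).2 hK.neg_right⟩

theorem sum_Psi_nonpos (l : ℕ) (b : β) : ∑ c, D.Psi l b c ≤ 0 := by
  obtain ⟨K, hK, -, hones⟩ := exists_nonneg_upperFactor_mul_ones hgen hirr
  let one : Matrix β Unit ℝ := fun _ _ => 1
  have hblocks : HasMatMul D.upperFactor (fun _ _ => 1)
      (blockColumn fun i => D.Psi i * one + D.A0 (i + 1) * one) :=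
    hasMatMul_tridiag_blockColumn (H := fun _ => one) (by simp) (by simp)
  have hrow : ∑ c, D.Psi l b c + ∑ c, D.A0 (l + 1) b c = -K (l, b) () := by
    have happly := congrFun₂ (hblocks.unique hones) (l, b) ()
    simp only [blockColumn, Matrix.add_apply, Matrix.mul_apply, Matrix.neg_apply] at happly
    simpa only [one, mul_one] using happly
  have hA0 : 0 ≤ ∑ c, D.A0 (l + 1) b c := Finset.sum_nonneg fun c _ => A0_nonneg hgen l b c
  linarith [hK (l, b) ()]

theorem summable_upperFactorInv_mul_of_nonneg {K : Type*} {H C : Matrix (ℕ × β) K ℝ}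
    (hH : EntrywiseNonneg H) (hC : EntrywiseNonneg C) (hHC : HasMatMul D.upperFactor H (-C))
    (p : ℕ × β) (k : K) :
    Summable (fun r => (-D.upperFactorInv) p r * C r k) ∧
      ∑' r, (-D.upperFactorInv) p r * C r k ≤ H p k := by
  have hN := neg_Psi_inv_nonneg hgen hirr
  refine summable_and_tsum_le_of_hasMatMul (A := -D.upperFactor)
    (fun i j hij => neg_nonpos.2 (upperFactor_offDiag_nonneg hgen hN hij))
    (neg_upperFactorInv_nonneg hgen hN) hH hC ?_ ?_ D.triangularlyExhausted_upperFactor.neg p k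
  · simpa only [neg_neg] using
      (upperFactorInv_mul_upperFactor (isUnit_Psi hgen hirr)).neg_left.neg_right
  · simpa only [neg_neg] using hHC.neg_left

theorem summable_upperFactorInv_mul_RLinv_of_pos {q : ℕ × β} (hq : 0 < D.rateToLevelZero q ())
    (p : ℕ × β) : Summable fun r => (-D.upperFactorInv) p r * D.RLinv r q := by
  have hN := neg_Psi_inv_nonneg hgen hirr
  obtain ⟨K, hK, hRK, hones⟩ := exists_nonneg_upperFactor_mul_ones hgen hirr
  have hsum := (summable_upperFactorInv_mul_of_nonneg hgen hirr (fun _ _ => zero_le_one) hK hones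
    p ()).1
  have hle : ∀ r, D.RLinv r q * D.rateToLevelZero q () ≤ K r () := fun r =>
    le_hasSum (hRK r ()) q fun s _ => mul_nonneg (RLinv_nonneg hgen hN r s)
      (rateToLevelZero_nonneg hgen s ())
  refine (summable_mul_right_iff hq.ne').1 (hsum.of_nonneg_of_le (fun r => ?_) fun r => ?_)
  · exact mul_nonneg (mul_nonneg (neg_upperFactorInv_nonneg hgen hN p r)
      (RLinv_nonneg hgen hN r q)) hq.le
  · rw [mul_assoc]
    exact mul_le_mul_of_nonneg_left (hle r) (neg_upperFactorInv_nonneg hgen hN p r)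

theorem summable_upperFactorInv_mul_RLinv (p q : ℕ × β) :
    Summable fun r => (-D.upperFactorInv) p r * D.RLinv r q := by
  have hN := neg_Psi_inv_nonneg hgen hirr
  have of_path : ∀ s a, Relation.ReflTransGen (fun i j => 0 < D.generator i j) s (Sum.inl a) →
      ∀ q, s = Sum.inr q → Summable fun r => (-D.upperFactorInv) p r * D.RLinv r q := by
    intro s a hpath
    induction hpath using Relation.ReflTransGen.head_induction_on with
    | refl => exact fun q hq => absurd hq Sum.inl_ne_inr
    | @head s t hst _ ih =>
      rintro q rfl
      rcases t with a' | q'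
      · exact summable_upperFactorInv_mul_RLinv_of_pos hgen hirr (hst.trans_le <|
          le_hasSum (hasSum_rateToLevelZero hgen q) a' fun _ _ => hgen.1 _ _ Sum.inr_ne_inl) p
      · exact summable_mul_of_hasMatMul_of_pos (neg_upperFactorInv_nonneg hgen hN p)
          (RLinv_nonneg hgen hN) (fun _ _ => Qhat_offDiag_nonneg hgen)
          (RLinv_mul_Qhat (isUnit_Psi hgen hirr)) (colFinite_tridiag _ _ _) hst (ih q' rfl)
  exact of_path (Sum.inr q) _ (hirr _ (Sum.inl (Classical.arbitrary α))) q rfl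

theorem upperFactorInv_mul_RLinv : HasMatMul D.upperFactorInv D.RLinv D.Qinv := fun p q => by
  simpa [Qinv] using (summable_upperFactorInv_mul_RLinv hgen hirr p q).neg.hasSum

theorem Qinv_nonpos (p q : ℕ × β) : D.Qinv p q ≤ 0 := by
  have hN := neg_Psi_inv_nonneg hgen hirr
  refine tsum_nonpos fun r => mul_nonpos_of_nonpos_of_nonneg ?_ (RLinv_nonneg hgen hN r q)
  exact neg_nonneg.1 (neg_upperFactorInv_nonneg hgen hN p r)

theorem isMaxNonposInverse_Qinv : IsMaxNonposInverse D.Qhat D.Qinv := by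
  have hu := isUnit_Psi hgen hirr
  refine ⟨isMatInverse_Qhat_of_upperFactorInv_mul hu (upperFactorInv_mul_RLinv hgen hirr),
    Qinv_nonpos hgen hirr, fun W hW hW_nonpos p q => ?_⟩
  have hUW : HasMatMul D.upperFactor W D.RLinv :=
    (HasMatMul.assoc_of_rowFinite D.rowFinite_RLinv (RLinv_mul_Qhat hu) hW.1).2 (.one_right _)
  have hle := (summable_upperFactorInv_mul_of_nonneg hgen hirr
    (fun i j => neg_nonneg.2 (hW_nonpos i j))
    (RLinv_nonneg hgen (neg_Psi_inv_nonneg hgen hirr)) hUW.neg_right p q).2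
  simp only [Matrix.neg_apply, neg_mul, tsum_neg] at hle
  exact neg_le_neg_iff.1 hle

theorem Qinv_factorization : HasMatMul₃ D.GUinv D.UDinv D.RLinv D.Qinv :=
  ⟨D.upperFactorInv, D.GUinv_mul_UDinv, upperFactorInv_mul_RLinv hgen hirr⟩

end MaximalInverse

end LDQBD

/-! ### The stationary distribution -/

section LevelShift

variable {β : Type*} [DecidableEq β]

/-- The `0`-`1` matrix that has its ones in block diagonal `k` below the main one: multiplying a
row vector by it from the right drops the first `k` levels. -/
def levelShift (k : ℕ) : Matrix (ℕ × β) (ℕ × β) ℝ :=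
  fun p q => if p = (q.1 + k, q.2) then 1 else 0

/-- The sum of all `levelShift k`: multiplying a row vector by it from the right sums over the
present and all higher levels. -/
def levelTailSum : Matrix (ℕ × β) (ℕ × β) ℝ :=
  fun p q => if q.1 ≤ p.1 ∧ p.2 = q.2 then 1 else 0

theorem hasVecMul_levelShift (v : ℕ × β → ℝ) (k : ℕ) :
    HasVecMul v (levelShift k) fun p => v (p.1 + k, p.2) := fun q => by
  simpa [levelShift] using hasSum_single (f := fun p => v p * levelShift k p q) (q.1 + k, q.2)
    fun p hp => by simp [levelShift, hp]

theorem hasPowerSum_levelShift : HasPowerSum (levelShift 1 : Matrix (ℕ × β) _ ℝ) levelTailSum := by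
  refine ⟨levelShift, ?_, fun k p => ?_, fun p q => ?_⟩
  · ext p q
    simp [levelShift, Matrix.one_apply]
  · have hsucc : levelShift (k + 1) p = fun q => levelShift k p (q.1 + 1, q.2) := by
      funext q
      simp only [levelShift, add_assoc, add_comm 1]
    exact hsucc ▸ hasVecMul_levelShift (levelShift k p) 1
  · have hshift : ∀ k, levelShift k p q = if k = p.1 - q.1 then levelTailSum p q else 0 := by
      intro k
      simp only [levelShift, levelTailSum, Prod.ext_iff]
      grind
    simpa only [hshift] using hasSum_ite_eq (p.1 - q.1) (levelTailSum p q)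

end LevelShift

namespace LDQBD

section Stationary

variable {α β : Type*} {D : LDQBD α β} {x : α ⊕ ℕ × β → ℝ}

theorem hasSum_tail {s : ℝ} (hx : HasSum x s) (i : ℕ) (b : β) :
    HasSum (fun j : ℕ => x (Sum.inr (i + j, b))) (tail x (i, b)) :=
  (hx.summable.comp_injective (i := fun j : ℕ => Sum.inr (i + j, b)) fun j k hjk => by
    simpa using hjk).hasSum

theorem tail_sub_tail_succ {s : ℝ} (hx : HasSum x s) (i : ℕ) (b : β) :
    tail x (i, b) - tail x (i + 1, b) = x (Sum.inr (i, b)) := by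
  have h := (hasSum_nat_add_iff' 1).2 (hasSum_tail hx i b)
  have h' : HasSum (fun j => x (Sum.inr (i + (j + 1), b))) (tail x (i + 1, b)) := by
    simpa only [add_assoc, add_comm 1] using hasSum_tail hx (i + 1) b
  have htail := h'.unique h
  simp only [Finset.sum_range_one, add_zero] at htail
  rw [htail, sub_sub_cancel]

theorem shiftedQhat_mul_of_Qhat_mul [DecidableEq β] {V : Matrix (ℕ × β) (ℕ × β) ℝ}
    (hV : HasMatMul D.Qhat V 1) : HasMatMul D.shiftedQhat V (levelShift 1) := by
  rintro ⟨_ | i, b⟩ q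
  · simp [shiftedQhat, levelShift]
  · simpa [shiftedQhat, levelShift, Matrix.one_apply, Prod.ext_iff] using hV (i, b) q

theorem levelShift_mul_Qhat [DecidableEq β] : HasMatMul (levelShift 1) D.Qhat D.shiftedQhat := by
  rintro ⟨_ | i, b⟩ q
  · simp [shiftedQhat, levelShift]
  · simpa [shiftedQhat, levelShift, Prod.ext_iff] using
      hasSum_single (f := fun p => levelShift 1 (i + 1, b) p * D.Qhat p q) (i, b) fun p hp => by
        have hne : (i + 1, b) ≠ (p.1 + 1, p.2) := fun h => hp <| by
          simpa [Prod.ext_iff, eq_comm] using h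
        rw [levelShift, if_neg hne, zero_mul]

theorem tail_mul_one_sub_levelShift [DecidableEq β] {s : ℝ} (hx : HasSum x s) :
    HasVecMul (tail x) (1 - levelShift 1) fun p => x (Sum.inr p) := fun q => by
  have h := (HasMatMul.one_right (Matrix.replicateRow Unit (tail x)) () q).sub
    (hasVecMul_levelShift (tail x) 1 q)
  simpa [mul_sub, tail_sub_tail_succ hx] using h

theorem levels_mul_levelTailSum [DecidableEq β] {s : ℝ} (hx : HasSum x s) :
    HasVecMul (fun p => x (Sum.inr p)) levelTailSum (tail x) := by
  rintro ⟨i, b⟩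
  have hinj : Function.Injective fun j : ℕ => ((i + j, b) : ℕ × β) := fun j k hjk => by
    simpa using hjk
  refine (hinj.hasSum_iff ?_).1 <| by
    simpa [Function.comp_def, levelTailSum] using hasSum_tail hx i b
  rintro ⟨j, c⟩ hj
  have hne : ¬(i ≤ j ∧ c = b) := by
    rintro ⟨hij, rfl⟩
    exact hj ⟨j - i, by simp [hij]⟩
  simp [levelTailSum, hne]

section Generator

variable [Fintype α]

theorem boundaryVec_apply (q : ℕ × β) : D.boundaryVec x q =
    -∑ a, x (Sum.inl a) * D.generator (Sum.inl a) (Sum.inr q) := by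
  have hupper : ∀ a, D.generator (Sum.inl a) (Sum.inr q) = if q.1 = 0 then D.B0 a q.2 else 0 :=
    fun _ => rfl
  simp only [boundaryVec, hupper, Matrix.vecMul, dotProduct]
  split_ifs <;> simp

theorem boundaryVec_nonpos (hgen : IsGenerator D.generator) (hx : ∀ i, 0 ≤ x i) (q : ℕ × β) :
    D.boundaryVec x q ≤ 0 := by
  rw [boundaryVec_apply, neg_nonpos]
  exact Finset.sum_nonneg fun a _ => mul_nonneg (hx _) (hgen.1 _ _ Sum.inl_ne_inr)

theorem hasVecMul_Qhat_boundaryVec_iff {ξ : ℕ × β → ℝ} {q : ℕ × β} :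
    HasSum (fun s => Sum.elim (fun a => x (Sum.inl a)) ξ s * D.generator s (Sum.inr q)) 0 ↔
      HasSum (fun p => ξ p * D.Qhat p q) (D.boundaryVec x q) := by
  rw [boundaryVec_apply, ← add_neg_cancel (∑ a, x (Sum.inl a) * D.generator (Sum.inl a)
    (Sum.inr q))]
  exact hasSum_sumType_iff (hasSum_fintype _)

theorem levels_mul_Qhat (hx : HasVecMul x D.generator 0) :
    HasVecMul (fun p => x (Sum.inr p)) D.Qhat (D.boundaryVec x) := fun q => by
  have h : HasSum (fun s => x s * D.generator s (Sum.inr q)) 0 := hx (Sum.inr q)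
  rw [← Sum.elim_comp_inl_inr x] at h
  exact hasVecMul_Qhat_boundaryVec_iff.1 h

theorem tail_mul_Qhat_sub_shiftedQhat [Finite β] {s : ℝ} (hx : HasSum x s)
    (hxQ : HasVecMul x D.generator 0) :
    HasVecMul (tail x) (D.Qhat - D.shiftedQhat) (D.boundaryVec x) := by
  classical
  exact hasVecMul_iff_hasMatMul.2 <| (HasMatMul.assoc_of_colFinite D.colFinite_Qhat
    (hasVecMul_iff_hasMatMul.1 (tail_mul_one_sub_levelShift hx))
    ((HasMatMul.one_left D.Qhat).sub_left levelShift_mul_Qhat)).1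
    (hasVecMul_iff_hasMatMul.1 (levels_mul_Qhat hxQ))

end Generator

section Uniqueness

variable [Fintype β] [DecidableEq β] (hgen : IsGenerator D.generator)
  (hirr : IsIrreducibleGenerator D.generator)
include hgen

omit [Fintype β] [DecidableEq β] in
theorem exists_nonpos_hasVecMul_generator [Fintype α] (hx : HasVecMul x D.generator 0)
    {m : ℕ × β → ℝ} (hm : ∀ p, 0 ≤ m p) (hmx : ∀ p, m p ≤ x (Sum.inr p))
    (hmQ : HasVecMul m D.Qhat (D.boundaryVec x)) :
    ∃ w, (∀ s, w s ≤ 0) ∧ HasVecMul (Sum.elim (fun a => x (Sum.inl a)) m) D.generator w := by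
  have rate_nonneg : ∀ p a, 0 ≤ D.generator (Sum.inr p) (Sum.inl a) :=
    fun _ _ => hgen.1 _ _ Sum.inr_ne_inl
  have column_le : ∀ p a, m p * D.generator (Sum.inr p) (Sum.inl a) ≤
      x (Sum.inr p) * D.generator (Sum.inr p) (Sum.inl a) := fun p a =>
    mul_le_mul_of_nonneg_right (hmx p) (rate_nonneg p a)
  have hsum : ∀ a, Summable fun p => m p * D.generator (Sum.inr p) (Sum.inl a) := fun a =>
    .of_nonneg_of_le (fun p => mul_nonneg (hm p) (rate_nonneg p a)) (fun p => column_le p a)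
      ((hx (Sum.inl a)).summable.comp_injective Sum.inr_injective)
  have hcolumn := fun a => (hasSum_sumType_iff (f := fun s =>
    Sum.elim (fun a => x (Sum.inl a)) m s * D.generator s (Sum.inl a)) (hasSum_fintype _)).2
    (hsum a).hasSum
  refine ⟨Sum.elim _ 0, ?_, Sum.rec hcolumn fun q => hasVecMul_Qhat_boundaryVec_iff.2 (hmQ q)⟩
  rintro (a | q)
  · exact hasSum_le (Sum.rec (fun _ => le_rfl) (column_le · a)) (hcolumn a) (hx (Sum.inl a))
  · exact le_rfl

variable [Nonempty α]
include hirr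

theorem exists_le_hasMatMul_Qinv {K : Type*} {Ξ V : Matrix K (ℕ × β) ℝ} (hV : RowFinite V)
    (hV_nonpos : EntrywiseNonneg (-V)) (hΞ : EntrywiseNonneg Ξ) (hΞV : HasMatMul Ξ D.Qhat V) :
    ∃ M : Matrix K (ℕ × β) ℝ, EntrywiseNonneg M ∧ (∀ k p, M k p ≤ Ξ k p) ∧
      HasMatMul V D.Qinv M := by
  have hu := isUnit_Psi hgen hirr
  have hN := neg_Psi_inv_nonneg hgen hirr
  obtain ⟨L, hL⟩ := HasMatMul.exists_of_rowFinite hV D.upperFactorInv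
  have hL_nonneg : EntrywiseNonneg L := fun k p => (hL k p).nonneg fun r =>
    mul_nonneg_of_nonpos_of_nonpos (neg_nonneg.1 (hV_nonpos k r))
      (neg_nonneg.1 (neg_upperFactorInv_nonneg hgen hN r p))
  have hΞL : HasMatMul Ξ (1 - D.RL) L :=
    (HasMatMul.assoc_of_colFinite D.colFinite_upperFactorInv hΞV (Qhat_mul_upperFactorInv hu)).1 hL
  have bound := summable_and_tsum_le_of_hasMatMul (A := (1 - D.RL).transpose)
    (B := D.RLinv.transpose)
    (fun i j hij => one_sub_RL_offDiag_nonpos hgen hN hij.symm)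
    (fun i j => RLinv_nonneg hgen hN j i) (fun p k => hΞ k p) (fun p k => hL_nonneg k p)
    (by simpa using HasMatMul.transpose D.isMatInverse_one_sub_RL.1) hΞL.transpose
    D.triangularlyExhausted_transpose_one_sub_RL
  let M : Matrix (ℕ × β) K ℝ := fun p k => ∑' r, D.RLinv.transpose p r * L.transpose r k
  have hLM : HasMatMul L D.RLinv M.transpose :=
    HasMatMul.transpose (A := D.RLinv.transpose) (B := L.transpose) fun p k => (bound p k).1.hasSum
  exact ⟨M.transpose, fun k p => tsum_nonneg fun r =>
      mul_nonneg (RLinv_nonneg hgen hN r p) (hL_nonneg k r), fun k p => (bound p k).2,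
    (HasMatMul.assoc_of_rowFinite hV hL (upperFactorInv_mul_RLinv hgen hirr)).1 hLM⟩

omit [Nonempty α] in
theorem boundaryVec_mul_Qinv [Fintype α] [DecidableEq α] {a : α}
    (hret : D.generator (Sum.inl a) (Sum.inl a) = 0 ∨ returnProb D.generator (Sum.inl a) = 1)
    (hx : ∀ s, 0 ≤ x s) (hxQ : HasVecMul x D.generator 0) :
    HasVecMul (D.boundaryVec x) D.Qinv fun p => x (Sum.inr p) := by
  have : Nonempty α := ⟨a⟩
  have hV : RowFinite (Matrix.replicateRow Unit (D.boundaryVec x)) := fun _ =>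
    ((Set.finite_singleton 0).prod Set.finite_univ).subset fun p hp => ⟨by
      by_contra h0
      exact hp (if_neg h0), trivial⟩
  obtain ⟨M, hM, hMx, hVM⟩ := exists_le_hasMatMul_Qinv hgen hirr hV
    (fun _ p => neg_nonneg.2 (boundaryVec_nonpos hgen hx p)) (fun _ p => hx (Sum.inr p))
    (hasVecMul_iff_hasMatMul.1 (levels_mul_Qhat hxQ))
  have hMQ : HasMatMul M D.Qhat _ := (HasMatMul.assoc_of_rowFinite hV hVM
    (isMaxNonposInverse_Qinv hgen hirr).1.2).2 (.one_right _)
  obtain ⟨w, hw, hmw⟩ := exists_nonpos_hasVecMul_generator hgen hxQ (hM ()) (hMx ()) (hMQ ())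
  suffices h : (fun p => x (Sum.inr p)) = M () by rw [h]; exact fun p => hVM () p
  funext p
  have : Nontrivial (α ⊕ ℕ × β) := ⟨_, _, Sum.inl_ne_inr (a := a) (b := p)⟩
  have hdiag := hirr.diag_neg hgen
  exact eq_of_hasVecMul_nonpos hgen hirr hdiag (hret.resolve_left (hdiag _).ne) hx
    (Sum.rec (fun _ => hx _) (hM ())) hxQ hmw (fun _ => le_rfl) hw rfl (Sum.inr p)

end Uniqueness

end Stationary

end LDQBD

theorem mainTheorem4 {α β : Type*} [Fintype α] [DecidableEq α] [Nonempty α]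
    [Fintype β] [DecidableEq β] (D : LDQBD α β)
    (hgen : IsGenerator D.generator)
    (hirr : IsIrreducibleGenerator D.generator)
    (hrec : IsPositiveRecurrent D.generator)
    (x : α ⊕ ℕ × β → ℝ) (hx : IsStationaryProb D.generator x) :
    -- the tail probabilities are convergent sums, and `π (Q̂ - ℚ) = -(x_0 A_0^{(0)}, 0, 0, …)`
    (∀ i b, HasSum (fun j : ℕ => x (Sum.inr (i + j, b))) (LDQBD.tail x (i, b))) ∧
    HasVecMul (LDQBD.tail x) (D.Qhat - D.shiftedQhat) (D.boundaryVec x) ∧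
    -- every `Ψ_l` is an invertible (transient) generator
    (∀ l, (∀ a b, a ≠ b → 0 ≤ D.Psi l a b) ∧ (∀ a, ∑ b, D.Psi l a b ≤ 0) ∧
      IsUnit (D.Psi l) ∧ ∀ a b, 0 ≤ (-(D.Psi l)⁻¹) a b) ∧
    -- `(𝐑_k)` and `(𝐆_k)` are the unique nonnegative solutions of their equations
    (D.IsNonnegRSolution D.R ∧
      ∀ S, D.IsNonnegRSolution S → ∀ k, 1 ≤ k → S k = D.R k) ∧
    (D.IsNonnegGSolution D.G ∧ ∀ S, D.IsNonnegGSolution S → S = D.G) ∧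
    -- and are computed recursively
    (∀ k, 1 ≤ k → IsUnit (D.R k * D.A0 k + D.A1 (k + 1)) ∧
      D.R (k + 1) = -(D.A2 (k + 2) * (D.R k * D.A0 k + D.A1 (k + 1))⁻¹)) ∧
    (∀ k, 1 ≤ k → IsUnit (D.A1 (k + 1) + D.A2 (k + 1) * D.G (k - 1)) ∧
      D.G k = -((D.A1 (k + 1) + D.A2 (k + 1) * D.G (k - 1))⁻¹ * D.A0 (k + 1))) ∧
    -- the LU-type RG-factorization of `Q̂`, and the inverses of its factors
    HasMatMul₃ (1 - D.RL) D.UD (1 - D.GU) D.Qhat ∧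
    IsMatInverse (1 - D.RL) D.RLinv ∧
    IsMatInverse D.UD D.UDinv ∧
    IsMatInverse (1 - D.GU) D.GUinv ∧
    -- the maximal non-positive inverse `V` of `Q̂` exists, and
    ∃ V : Matrix (ℕ × β) (ℕ × β) ℝ, IsMaxNonposInverse D.Qhat V ∧
      -- `V = (I - 𝔾_U)⁻¹ 𝕌_D⁻¹ (I - ℝ_L)⁻¹`,
      HasMatMul₃ D.GUinv D.UDinv D.RLinv V ∧
      -- and, with `W = ℚ V`, `S = ∑_k W ^ k` and `u = -(x_0 A_0^{(0)}, 0, 0, …) V`,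
      -- one has `π (I - W) = u` and `π = u S`
      ∃ (W S : Matrix (ℕ × β) (ℕ × β) ℝ) (u : ℕ × β → ℝ),
        HasMatMul D.shiftedQhat V W ∧ HasPowerSum W S ∧
        HasVecMul (D.boundaryVec x) V u ∧
        HasVecMul (LDQBD.tail x) (1 - W) u ∧
        HasVecMul u S (LDQBD.tail x) := by
  have hu := LDQBD.isUnit_Psi hgen hirr
  have hN := LDQBD.neg_Psi_inv_nonneg hgen hirr
  have hR := LDQBD.isNonnegRSolution_R hu fun k => LDQBD.R_succ_nonneg hgen (hN k)
  have hG := LDQBD.isNonnegGSolution_G hu fun k => LDQBD.G_nonneg hgen (hN k)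
  have hmax := LDQBD.isMaxNonposInverse_Qinv hgen hirr
  refine ⟨LDQBD.hasSum_tail hx.2.1, LDQBD.tail_mul_Qhat_sub_shiftedQhat hx.2.1 hx.2.2,
    fun l => ⟨fun _ _ => LDQBD.Psi_offDiag_nonneg hgen hN l,
      LDQBD.sum_Psi_nonpos hgen hirr l, hu l, hN l⟩,
    ⟨hR, fun S hS k hk => ?_⟩, ⟨hG, fun S hS => hS.eq_G hu⟩,
    fun k hk => ?_, fun k hk => ?_,
    LDQBD.Qhat_factorization hu, D.isMatInverse_one_sub_RL, LDQBD.isMatInverse_UD hu,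
    D.isMatInverse_one_sub_GU, D.Qinv, hmax, LDQBD.Qinv_factorization hgen hirr,
    levelShift 1, levelTailSum, fun p => x (Sum.inr p),
    LDQBD.shiftedQhat_mul_of_Qhat_mul hmax.1.1, hasPowerSum_levelShift,
    LDQBD.boundaryVec_mul_Qinv hgen hirr
      ((hrec (Sum.inl (Classical.arbitrary α))).imp_right And.left) hx.1 hx.2.2,
    LDQBD.tail_mul_one_sub_levelShift hx.2.1, LDQBD.levels_mul_levelTailSum hx.2.1⟩
  all_goals obtain ⟨k, rfl⟩ := Nat.exists_eq_add_of_le' hk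
  · exact hS.succ_eq_R hu k
  · exact ⟨D.R_mul_A0_add_A1 k ▸ hu (k + 1), D.R_recursion k⟩
  · exact ⟨D.A1_add_A2_mul_G k ▸ hu (k + 1), D.G_recursion k⟩
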